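/- Let $n\in\mathbb N$, $1<p\le q<n$, $\alpha\in(0,\infty)$ with $\frac qp\le 1+\frac{\alpha}{n}$, and put $q^*=\frac{nq}{n-q}$. Then there is a constant $c>0$ depending only on $n,p,q,\alpha$ and $[a]_\alpha$ such that the following holds. Let $B=B_R(x_0)\subset\mathbb R^n$ be an open ball of radius $R>0$, and let $a\in\mathcal Z^\alpha(B)$; that is, $a:B\to[0,\infty)$ is measurable and there is a constant $C>0$ with $a(x)\le C\,(a(y)+|x-y|^\alpha)$ for all $x,y\in B$. Write $[a]_\alpha$ for the infimum of such constants $C$. Let $\eta\in L^\infty(B)$ satisfy $0\le\eta\le1$ a.e. and $\|\eta\|_{L^1(B)}\ge|\tfrac12B|$, where $\tfrac12B=B_{R/2}(x_0)$. Let $u\in W^{1,p}(B)$ be real-valued with weak gradient $Du$, and suppose that $$\int_B a|Du|^q\,dx<\infty\qquad\text{and}\qquad u_{B,\eta}:=\frac1{\|\eta\|_{L^1(B)}}\int_B u\,\eta\,dx=0 .$$ Then $a^{q^*/q}|u|^{q^*}$ is integrable on $B$ and $$\left(\frac1{|B|}\int_B a^{\frac{q^*}{q}}\left|\frac uR\right|^{q^*}dx\right)^{\frac1{q^*}}\le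 c\left(\frac1{|B|}\int_B a|Du|^q\,dx\right)^{\frac1q}+c\,R^{\frac\alpha q}\left(\frac1{|B|}\int_B|Du|^p\,dx\right)^{\frac1p}.$$ -/

import Mathlib

open MeasureTheory Metric
open scoped ContDiff

noncomputable section

namespace DoublePhase

/-- `Rn n` is Euclidean space `ℝⁿ`, with the Euclidean norm. -/
abbrev Rn (n : ℕ) : Type := EuclideanSpace ℝ (Fin n)

/-- The admissible constants for a coefficient `a` on `Ω`:
all `C > 0` with `a x ≤ C (a y + |x - y| ^ α)` for any `x, y ∈ Ω`. -/
def zConstants {n : ℕ} (α : ℝ) (Ω : Set (Rn n)) (a : Rn n → ℝ) : Set ℝ :=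
  {C : ℝ | 0 < C ∧ ∀ x ∈ Ω, ∀ y ∈ Ω, a x ≤ C * (a y + ‖x - y‖ ^ α)}

/-- The class `𝒵^α(Ω)`: (Lebesgue) measurable functions `a : Ω → [0, ∞)` for which
`a x ≤ C (a y + |x - y| ^ α)` holds on `Ω` with some constant `C > 0`.
Only the values of `a` on `Ω` matter. -/
structure MemZ {n : ℕ} (α : ℝ) (Ω : Set (Rn n)) (a : Rn n → ℝ) : Prop where
  aemeasurable : AEMeasurable a (volume.restrict Ω)
  nonneg : ∀ x ∈ Ω, 0 ≤ a x
  exists_const : (zConstants α Ω a).Nonempty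

/-- `[a]_{α,Ω}`: the infimum of the admissible constants. -/
def zSeminorm {n : ℕ} (α : ℝ) (Ω : Set (Rn n)) (a : Rn n → ℝ) : ℝ :=
  sInf (zConstants α Ω a)

/-- `Du` is the weak gradient of `u` on the open set `Ω`: both are locally integrable on `Ω` and
`∫_Ω u ∂ᵢφ = - ∫_Ω (Du)ᵢ φ` for every `φ ∈ C_c^∞(Ω)` and every `i`. -/
structure HasWeakGradient {n : ℕ} (Ω : Set (Rn n)) (u : Rn n → ℝ) (Du : Rn n → Rn n) :
    Prop where
  locallyIntegrableOn : LocallyIntegrableOn u Ω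
  locallyIntegrableOn_grad : LocallyIntegrableOn Du Ω
  integral_eq : ∀ φ : Rn n → ℝ, ContDiff ℝ ∞ φ → HasCompactSupport φ → tsupport φ ⊆ Ω →
    ∀ i : Fin n, ∫ x in Ω, u x * fderiv ℝ φ x (EuclideanSpace.single i 1)
      = - ∫ x in Ω, Du x i * φ x

/-- `u ∈ W^{1,p}(Ω)` with weak gradient `Du`. -/
structure MemW1p {n : ℕ} (p : ℝ) (Ω : Set (Rn n)) (u : Rn n → ℝ) (Du : Rn n → Rn n) :
    Prop where
  memLp : MemLp u (ENNReal.ofReal p) (volume.restrict Ω)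
  hasWeakGradient : HasWeakGradient Ω u Du
  memLp_grad : MemLp Du (ENNReal.ofReal p) (volume.restrict Ω)

/-- The weighted average `f_{B,η} = (1 / ‖η‖_{L¹(B)}) ∫_B f η`. -/
def weightedMean {n : ℕ} (B : Set (Rn n)) (η f : Rn n → ℝ) : ℝ :=
  1 / (∫ x in B, |η x|) * ∫ x in B, f x * η x

/-- The Sobolev exponent `q* = nq / (n - q)` (for `q < n`). -/
def sobolevExponent (n : ℕ) (q : ℝ) : ℝ := n * q / (n - q)

end DoublePhase

end

/-!
The proof bounds `u` pointwise by a Riesz potential of its gradient and lets the weight `a` pass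
through the kernel.

Since the weighted mean of `u` vanishes, `u x` is at most a multiple of the mean of `|u x - u y|`
over `y ∈ B`, and for a Sobolev function on a ball that mean is bounded by
`∫_B |Du z| |x - z|^(1 - n) dz` for almost every `x` (`ae_lintegral_enorm_sub_le_rieszPotential`).
The class `𝒵^α` is exactly what is needed to move the weight under the integral:
`a(x)^(1/q)` is at most `[a]^(1/q) (a(z)^(1/q) + |x - z|^(α/q))`. Hence `a^(1/q) |u|` is controlled
by the Riesz potential of order `1` of `a^(1/q) |Du| ∈ L^q` plus the potential of order `1 + α/q`
of `|Du| ∈ L^p` (`MemZ.ofReal_rpow_mul_rieszPotential_le`). On a ball the second order may be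
lowered to `β = 1 + n/p - n/q`; that `β ≤ 1 + α/q` is the hypothesis `q/p ≤ 1 + α/n`. Both
potentials then map into `L^(q*)` by the Hardy–Littlewood–Sobolev inequality
(`lintegral_rieszPotential_rpow_le`), and scaling gives the powers of `R`.

The Hardy–Littlewood–Sobolev inequality is obtained by Hedberg's argument from the maximal
theorem `lintegral_maximalFunction_rpow_le`, which in turn comes from the Vitali covering lemma and
the layer cake formula. The potential estimate is proved for `C¹` functions by integrating along
segments, and carried over to Sobolev functions by mollification: the mollified gradients are
dominated by the maximal function of the gradient, whose potential is finite almost everywhere, so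
that dominated convergence applies.

Integrals are handled as lower Lebesgue integrals in `[0, ∞]` up to the last step.
-/

namespace DoublePhase

open Module (finrank)
open scoped ENNReal NNReal Convolution

/-! ### The Hardy–Littlewood maximal function -/

section MaximalFunction

theorem lintegral_ball_eq_iSup {E : Type*} [PseudoMetricSpace E] [MeasurableSpace E]
    {μ : Measure E} (f : E → ℝ≥0∞) (x : E) (r : ℝ) :
    ∫⁻ y in ball x r, f y ∂μ = ⨆ k : ℕ, ∫⁻ y in ball x (r - 1 / ((k : ℝ) + 1)), f y ∂μ := by
  have hU : ball x r = ⋃ k : ℕ, ball x (r - 1 / (k + 1)) := by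
    ext y
    simp only [mem_ball, Set.mem_iUnion]
    constructor
    · intro hy
      obtain ⟨k, hk⟩ := exists_nat_one_div_lt (sub_pos.2 hy)
      exact ⟨k, by linarith⟩
    · rintro ⟨k, hk⟩
      have : (0 : ℝ) < 1 / (k + 1) := by positivity
      linarith
  have hmono : Monotone fun k : ℕ => ball x (r - 1 / ((k : ℝ) + 1)) := by
    intro i j hij
    apply ball_subset_ball
    gcongr
  conv_lhs => rw [hU]
  rw [setLIntegral_iUnion_of_directed f hmono.directed_le]

variable {E : Type*} [NormedAddCommGroup E] [MeasurableSpace E]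

/-- The centred Hardy–Littlewood maximal function, for functions with values in `[0, ∞]`. -/
noncomputable def maximalFunction (μ : Measure E) (f : E → ℝ≥0∞) (x : E) : ℝ≥0∞ :=
  ⨆ (r : ℝ) (_ : 0 < r), (μ (ball x r))⁻¹ * ∫⁻ y in ball x r, f y ∂μ

variable {μ : Measure E}

theorem maximalFunction_congr_ae {f g : E → ℝ≥0∞} (h : f =ᵐ[μ] g) :
    maximalFunction μ f = maximalFunction μ g := by
  funext x
  refine iSup_congr fun r => iSup_congr fun _ => ?_
  rw [lintegral_congr_ae (ae_restrict_of_ae h)]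

variable [NormedSpace ℝ E] [FiniteDimensional ℝ E] [μ.IsAddHaarMeasure]

theorem lintegral_ball_le_maximalFunction (f : E → ℝ≥0∞) (x : E) {r : ℝ} (hr : 0 < r) :
    ∫⁻ y in ball x r, f y ∂μ ≤ μ (ball x r) * maximalFunction μ f x := by
  have h0 : μ (ball x r) ≠ 0 := (measure_ball_pos μ x hr).ne'
  have h1 : μ (ball x r) ≠ ⊤ := measure_ball_lt_top.ne
  rw [← ENNReal.inv_mul_le_iff h0 h1]
  exact le_iSup₂_of_le r hr le_rfl

theorem lt_maximalFunction_iff (f : E → ℝ≥0∞) (x : E) (t : ℝ≥0∞) :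
    t < maximalFunction μ f x ↔
      ∃ r : ℝ, 0 < r ∧ μ (ball x r) * t < ∫⁻ y in ball x r, f y ∂μ := by
  simp only [maximalFunction, lt_iSup_iff, exists_prop]
  refine exists_congr fun r => and_congr_right fun hr => ?_
  have h0 : μ (ball x r) ≠ 0 := (measure_ball_pos μ x hr).ne'
  have h1 : μ (ball x r) ≠ ⊤ := measure_ball_lt_top.ne
  rw [← not_le, ← not_le, ENNReal.inv_mul_le_iff h0 h1]

variable [BorelSpace E]

theorem isOpen_lt_maximalFunction (f : E → ℝ≥0∞) (t : ℝ≥0∞) :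
    IsOpen {x | t < maximalFunction μ f x} := by
  rw [Metric.isOpen_iff]
  intro x hx
  obtain ⟨r, hr, h⟩ := (lt_maximalFunction_iff f x t).1 hx
  rw [lintegral_ball_eq_iSup, lt_iSup_iff] at h
  obtain ⟨k, hk⟩ := h
  refine ⟨1 / ((k : ℝ) + 1), by positivity, fun y hy => ?_⟩
  refine (lt_maximalFunction_iff f y t).2 ⟨r, hr, ?_⟩
  rw [Measure.addHaar_ball_center] at hk ⊢
  refine hk.trans_le (lintegral_mono_set ?_)
  apply ball_subset_ball'
  rw [mem_ball, dist_comm] at hy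
  linarith

theorem measurable_maximalFunction (f : E → ℝ≥0∞) : Measurable (maximalFunction μ f) :=
  measurable_of_Ioi fun t => (isOpen_lt_maximalFunction f t).measurableSet

/-- The weak type `(1, 1)` estimate. It follows from the Vitali covering lemma. -/
theorem mul_measure_lt_maximalFunction_le [Nontrivial E] (f : E → ℝ≥0∞) (t : ℝ≥0∞) :
    t * μ {x | t < maximalFunction μ f x} ≤ 5 ^ finrank ℝ E * ∫⁻ x, f x ∂μ := by
  rcases eq_or_ne t 0 with rfl | ht0
  · simp
  rcases eq_or_ne t ⊤ with rfl | htt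
  · simp
  rcases eq_or_ne (∫⁻ x, f x ∂μ) ⊤ with hf | hf
  · rw [hf, ENNReal.mul_top (by simp)]; exact le_top
  set A := {x | t < maximalFunction μ f x}
  have hA : ∀ x : A, ∃ r : ℝ, 0 < r ∧ μ (ball (x : E) r) * t < ∫⁻ y in ball (x : E) r, f y ∂μ :=
    fun x => (lt_maximalFunction_iff f x t).1 x.2
  choose r hr hrt using hA
  -- the radii are bounded because `f` has finite integral
  have hbd : ∃ R : ℝ, ∀ x : A, r x ≤ R := by
    have h1 : μ (ball (0 : E) 1) ≠ 0 := (measure_ball_pos μ 0 one_pos).ne'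
    set Q := (∫⁻ x, f x ∂μ) / (μ (ball (0 : E) 1) * t)
    have hQ : Q ≠ ⊤ := ENNReal.div_ne_top hf (by simp [h1, ht0])
    refine ⟨max 1 Q.toReal, fun x => ?_⟩
    by_contra! hx
    obtain ⟨hx1, hxQ⟩ := max_lt_iff.1 hx
    have h3 : ENNReal.ofReal (r x) * (μ (ball (0 : E) 1) * t) ≤ ∫⁻ x, f x ∂μ := by
      calc ENNReal.ofReal (r x) * (μ (ball (0 : E) 1) * t)
          ≤ ENNReal.ofReal (r x ^ finrank ℝ E) * (μ (ball (0 : E) 1) * t) := by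
            gcongr
            exact le_self_pow₀ hx1.le Module.finrank_pos.ne'
        _ = μ (ball (x : E) (r x)) * t := by
            rw [Measure.addHaar_ball_of_pos μ _ (hr x), mul_assoc]
        _ ≤ ∫⁻ y in ball (x : E) (r x), f y ∂μ := (hrt x).le
        _ ≤ _ := setLIntegral_le_lintegral _ _
    rw [← ENNReal.le_div_iff_mul_le (by simp [h1, ht0]) (Or.inr hf)] at h3
    exact absurd (ENNReal.ofReal_le_iff_le_toReal hQ |>.1 h3) (not_le.2 hxQ)
  obtain ⟨R, hR⟩ := hbd
  obtain ⟨u, -, hdisj, hcov⟩ := Vitali.exists_disjoint_subfamily_covering_enlargement_closedBall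
    (Set.univ : Set A) (fun x => (x : E)) r R (fun x _ => hR x) 5 (by norm_num)
  have hcount : u.Countable := by
    refine hdisj.countable_of_nonempty_interior fun x _ => ?_
    rw [interior_closedBall _ (hr x).ne']
    exact nonempty_ball.2 (hr x)
  have hsub : A ⊆ ⋃ b ∈ u, closedBall (b : E) (5 * r b) := by
    intro x hx
    obtain ⟨b, hb, hxb⟩ := hcov ⟨x, hx⟩ trivial
    exact Set.mem_biUnion hb (hxb (mem_closedBall_self (hr _).le))
  calc t * μ A ≤ t * ∑' b : u, μ (closedBall (b : E) (5 * r b)) := by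
        gcongr
        exact (measure_mono hsub).trans (measure_biUnion_le μ hcount _)
    _ = ∑' b : u, t * μ (closedBall (b : E) (5 * r b)) := ENNReal.tsum_mul_left.symm
    _ ≤ ∑' b : u, 5 ^ finrank ℝ E * ∫⁻ y in closedBall (b : E) (r b), f y ∂μ := by
        refine ENNReal.tsum_le_tsum fun b => ?_
        have h5 : μ (closedBall (b : E) (5 * r b)) =
            5 ^ finrank ℝ E * μ (ball (b : E) (r b)) := by
          rw [Measure.addHaar_closedBall_mul_of_pos μ _ (by norm_num : (0 : ℝ) < 5),
            ENNReal.ofReal_pow (by norm_num), Measure.addHaar_closedBall_eq_addHaar_ball,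
            Measure.addHaar_ball_center μ (b : E)]
          norm_num
        rw [h5, mul_left_comm]
        gcongr
        rw [mul_comm]
        exact (hrt b).le.trans (lintegral_mono_set ball_subset_closedBall)
    _ = 5 ^ finrank ℝ E * ∑' b : u, ∫⁻ y in closedBall (b : E) (r b), f y ∂μ :=
        ENNReal.tsum_mul_left
    _ = 5 ^ finrank ℝ E * ∫⁻ y in ⋃ b ∈ u, closedBall (b : E) (r b), f y ∂μ := by
        rw [lintegral_biUnion hcount (fun _ _ => measurableSet_closedBall) hdisj]
    _ ≤ _ := by
        gcongr
        exact Measure.restrict_le_self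

/-- The weak type estimate with `f` cut off below height `t / 2`; the part of `f` below that height
contributes at most `t / 2` to the maximal function. -/
theorem mul_measure_lt_maximalFunction_le_indicator [Nontrivial E] {f : E → ℝ≥0∞}
    (t : ℝ≥0∞) :
    t * μ {x | t < maximalFunction μ f x} ≤
      2 * 5 ^ finrank ℝ E * ∫⁻ x, {x | t < 2 * f x}.indicator f x ∂μ := by
  set g := {x | t < 2 * f x}.indicator f with hg
  have hfg : ∀ x, f x ≤ t / 2 + g x := by
    intro x
    by_cases hx : t < 2 * f x
    · rw [hg, Set.indicator_of_mem (by exact hx)]; exact le_add_self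
    · rw [hg, Set.indicator_of_notMem (by exact hx), add_zero,
        ENNReal.le_div_iff_mul_le (by simp) (by simp), mul_comm]
      exact not_lt.1 hx
  have hM : ∀ x, maximalFunction μ f x ≤ t / 2 + maximalFunction μ g x := by
    intro x
    refine iSup₂_le fun r hr => ?_
    have h0 : μ (ball x r) ≠ 0 := (measure_ball_pos μ x hr).ne'
    have h1 : μ (ball x r) ≠ ⊤ := measure_ball_lt_top.ne
    rw [ENNReal.inv_mul_le_iff h0 h1, mul_add]
    calc ∫⁻ y in ball x r, f y ∂μ ≤ ∫⁻ y in ball x r, (t / 2 + g y) ∂μ :=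
          lintegral_mono fun y => hfg y
      _ = μ (ball x r) * (t / 2) + ∫⁻ y in ball x r, g y ∂μ := by
          rw [lintegral_add_left measurable_const, setLIntegral_const, mul_comm]
      _ ≤ _ := by gcongr; exact lintegral_ball_le_maximalFunction g x hr
  have hsub : {x | t < maximalFunction μ f x} ⊆ {x | t / 2 < maximalFunction μ g x} := by
    intro x hx
    simp only [Set.mem_ofPred_eq] at hx ⊢
    by_contra! h
    refine absurd (hx.trans_le ((hM x).trans (add_le_add_right h _))) ?_
    simp
  calc t * μ {x | t < maximalFunction μ f x}
      ≤ (2 * (t / 2)) * μ {x | t / 2 < maximalFunction μ g x} := by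
        gcongr
        rw [ENNReal.mul_div_cancel (by simp) (by simp)]
    _ = 2 * ((t / 2) * μ {x | t / 2 < maximalFunction μ g x}) := mul_assoc _ _ _
    _ ≤ 2 * (5 ^ finrank ℝ E * ∫⁻ x, g x ∂μ) := by
        gcongr 2 * ?_
        exact mul_measure_lt_maximalFunction_le g _
    _ = _ := (mul_assoc _ _ _).symm

end MaximalFunction

/-! ### Integrals of powers and the layer cake formula -/

section LayerCake

theorem lintegral_Ioo_rpow {s b : ℝ} (hs : 0 < s) (hb : 0 ≤ b) :
    ∫⁻ t in Set.Ioo 0 b, ENNReal.ofReal (s * t ^ (s - 1)) = ENNReal.ofReal (b ^ s) := by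
  have hint : IntervalIntegrable (fun t : ℝ => s * t ^ (s - 1)) volume 0 b :=
    (intervalIntegral.intervalIntegrable_rpow' (by linarith)).const_mul s
  rw [restrict_Ioo_eq_restrict_Ioc, ← ofReal_integral_eq_lintegral_ofReal]
  · rw [← intervalIntegral.integral_of_le hb, intervalIntegral.integral_const_mul,
      integral_rpow (Or.inl (by linarith)), sub_add_cancel, Real.zero_rpow hs.ne', sub_zero,
      mul_div_cancel₀ _ hs.ne']
  · exact (intervalIntegrable_iff_integrableOn_Ioc_of_le hb).1 hint
  · refine (ae_restrict_iff' measurableSet_Ioc).2 (Filter.Eventually.of_forall fun t ht => ?_)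
    have := Real.rpow_nonneg ht.1.le (s - 1)
    positivity

theorem lintegral_Ioi_rpow {s b : ℝ} (hs : 0 < s) (hb : 0 < b) :
    ∫⁻ t in Set.Ioi b, ENNReal.ofReal (s * t ^ (-s - 1)) = ENNReal.ofReal (b ^ (-s)) := by
  rw [← ofReal_integral_eq_lintegral_ofReal]
  · rw [integral_const_mul, integral_Ioi_rpow_of_lt (by linarith) hb, sub_add_cancel]
    congr 1
    field_simp
  · exact (integrableOn_Ioi_rpow_of_lt (by linarith) hb).const_mul s
  · refine (ae_restrict_iff' measurableSet_Ioi).2 (Filter.Eventually.of_forall fun t ht => ?_)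
    have := Real.rpow_nonneg (hb.trans ht).le (-s - 1)
    positivity

/-- The layer cake formula for a power of a single extended number. -/
theorem rpow_eq_lintegral_indicator {s : ℝ} (hs : 0 < s) (y : ℝ≥0∞) :
    y ^ s = ∫⁻ t in Set.Ioi (0 : ℝ), ENNReal.ofReal (s * t ^ (s - 1)) *
      {t : ℝ | ENNReal.ofReal t < y}.indicator 1 t := by
  have key : ∀ b : ℝ, 0 ≤ b → ∀ y : ℝ≥0∞, ENNReal.ofReal b ≤ y → ENNReal.ofReal b ^ s ≤
      ∫⁻ t in Set.Ioi (0 : ℝ), ENNReal.ofReal (s * t ^ (s - 1)) *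
        {t : ℝ | ENNReal.ofReal t < y}.indicator 1 t := by
    intro b hb y hy
    rw [ENNReal.ofReal_rpow_of_nonneg hb hs.le, ← lintegral_Ioo_rpow hs hb]
    refine le_trans ?_ (lintegral_mono_set (t := Set.Ioi 0) (s := Set.Ioo 0 b) fun t ht => ht.1)
    refine setLIntegral_mono_ae' measurableSet_Ioo (Filter.Eventually.of_forall fun t ht => ?_)
    have : ENNReal.ofReal t < y :=
      ((ENNReal.ofReal_lt_ofReal_iff (ht.1.trans ht.2)).2 ht.2).trans_le hy
    rw [Set.indicator_of_mem (by exact this)]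
    simp
  rcases eq_or_ne y ⊤ with rfl | hy
  · rw [ENNReal.top_rpow_of_pos hs]
    refine (ENNReal.eq_top_of_forall_nnreal_le fun c => ?_).symm
    have h := key ((c : ℝ) ^ (1 / s)) (by positivity) ⊤ le_top
    rw [ENNReal.ofReal_rpow_of_nonneg (by positivity) hs.le, ← Real.rpow_mul c.coe_nonneg,
      one_div_mul_cancel hs.ne', Real.rpow_one, ENNReal.ofReal_coe_nnreal] at h
    exact h
  · obtain ⟨b, rfl⟩ : ∃ b : ℝ≥0, y = b := ⟨y.toNNReal, (ENNReal.coe_toNNReal hy).symm⟩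
    refine le_antisymm (by simpa using key b b.coe_nonneg b (by simp)) ?_
    rw [← ENNReal.ofReal_coe_nnreal, ENNReal.ofReal_rpow_of_nonneg b.coe_nonneg hs.le,
      ← lintegral_Ioo_rpow hs b.coe_nonneg, ← lintegral_indicator measurableSet_Ioo,
      ← lintegral_indicator measurableSet_Ioi]
    refine lintegral_mono fun t => ?_
    by_cases ht : t ∈ Set.Ioi (0 : ℝ)
    · by_cases htb : t < b
      · rw [Set.indicator_of_mem (s := Set.Ioo _ _) ⟨ht, htb⟩, Set.indicator_of_mem ht,
          Set.indicator_of_mem (s := {t : ℝ | ENNReal.ofReal t < ENNReal.ofReal b})]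
        · simp
        · exact (ENNReal.ofReal_lt_ofReal_iff (lt_trans ht htb)).2 htb
      · rw [Set.indicator_of_mem ht,
          Set.indicator_of_notMem (s := {t : ℝ | ENNReal.ofReal t < ENNReal.ofReal b})]
        · simp
        · exact not_lt.2 (ENNReal.ofReal_le_ofReal (not_lt.1 htb))
    · rw [Set.indicator_of_notMem ht]; exact zero_le

end LayerCake

/-! ### The maximal theorem -/

section MaximalFunction

variable {E : Type*} [NormedAddCommGroup E] [MeasurableSpace E] {μ : Measure E}
  [BorelSpace E] [NormedSpace ℝ E] [FiniteDimensional ℝ E] [μ.IsAddHaarMeasure]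

/-- The Hardy–Littlewood maximal theorem: the maximal function is bounded on `L^p` for `p > 1`. -/
theorem lintegral_maximalFunction_rpow_le [Nontrivial E] {p : ℝ} (hp : 1 < p) :
    ∃ C : ℝ≥0, ∀ f : E → ℝ≥0∞, AEMeasurable f μ →
      ∫⁻ x, maximalFunction μ f x ^ p ∂μ ≤ C * ∫⁻ x, f x ^ p ∂μ := by
  suffices H : ∃ C : ℝ≥0, ∀ f : E → ℝ≥0∞, Measurable f →
      ∫⁻ x, maximalFunction μ f x ^ p ∂μ ≤ C * ∫⁻ x, f x ^ p ∂μ by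
    obtain ⟨C, hC⟩ := H
    refine ⟨C, fun f hf => ?_⟩
    have h := hC _ hf.measurable_mk
    rwa [← maximalFunction_congr_ae hf.ae_eq_mk,
      ← lintegral_congr_ae (hf.ae_eq_mk.mono fun x hx => congrArg (· ^ p) hx)] at h
  have hp0 : 0 < p := by linarith
  have hp1 : 0 < p - 1 := by linarith
  obtain ⟨K, hK⟩ : ∃ K : ℝ≥0, (2 * 5 ^ finrank ℝ E : ℝ≥0∞) = K :=
    ⟨2 * 5 ^ finrank ℝ E, by push_cast; rfl⟩
  refine ⟨K * Real.toNNReal (p / (p - 1)) * Real.toNNReal (2 ^ (p - 1)), fun f hf => ?_⟩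
  have hMm := measurable_maximalFunction (μ := μ) f
  have hset : MeasurableSet {z : E × ℝ | ENNReal.ofReal z.2 < maximalFunction μ f z.1} :=
    measurableSet_lt (by fun_prop) (hMm.comp measurable_fst)
  have hset2 : MeasurableSet {z : E × ℝ | ENNReal.ofReal z.2 < 2 * f z.1} :=
    measurableSet_lt (by fun_prop) (by fun_prop)
  have hpow : ∀ s : ℝ, Measurable fun t : ℝ => ENNReal.ofReal (s * t ^ (s - 1)) := by
    intro s; fun_prop
  have hpt : ∀ t ∈ Set.Ioi (0 : ℝ), ENNReal.ofReal (p * t ^ (p - 1)) *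
      μ {x | ENNReal.ofReal t < maximalFunction μ f x} ≤
      (K * Real.toNNReal (p / (p - 1)) : ℝ≥0) * (ENNReal.ofReal ((p - 1) * t ^ (p - 1 - 1)) *
        ∫⁻ x, {x | ENNReal.ofReal t < 2 * f x}.indicator f x ∂μ) := by
    intro t (ht : 0 < t)
    have e : p * t ^ (p - 1) = p / (p - 1) * ((p - 1) * t ^ (p - 1 - 1)) * t := by
      rw [Real.rpow_sub_one ht.ne' (p - 1)]; field_simp
    rw [e, ENNReal.ofReal_mul (by positivity), ENNReal.ofReal_mul (by positivity), mul_assoc]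
    refine (mul_le_mul_right (mul_measure_lt_maximalFunction_le_indicator _) _).trans_eq ?_
    rw [hK, ENNReal.coe_mul, ← ENNReal.ofReal]
    generalize ENNReal.ofReal (p / (p - 1)) = c
    generalize ∫⁻ x, {x | ENNReal.ofReal t < 2 * f x}.indicator f x ∂μ = I
    ring
  calc ∫⁻ x, maximalFunction μ f x ^ p ∂μ
      = ∫⁻ x, (∫⁻ t in Set.Ioi (0 : ℝ), ENNReal.ofReal (p * t ^ (p - 1)) *
          {t : ℝ | ENNReal.ofReal t < maximalFunction μ f x}.indicator 1 t) ∂μ := by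
        simp_rw [← rpow_eq_lintegral_indicator hp0]
    _ = ∫⁻ t in Set.Ioi (0 : ℝ), ∫⁻ x, ENNReal.ofReal (p * t ^ (p - 1)) *
          {t : ℝ | ENNReal.ofReal t < maximalFunction μ f x}.indicator 1 t ∂μ := by
        refine lintegral_lintegral_swap (Measurable.aemeasurable ?_)
        exact ((hpow p).comp measurable_snd).mul
          ((measurable_one.indicator hset : Measurable ({z : E × ℝ |
            ENNReal.ofReal z.2 < maximalFunction μ f z.1}.indicator (1 : E × ℝ → ℝ≥0∞))))
    _ = ∫⁻ t in Set.Ioi (0 : ℝ), ENNReal.ofReal (p * t ^ (p - 1)) *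
          μ {x | ENNReal.ofReal t < maximalFunction μ f x} := by
        refine lintegral_congr fun t => ?_
        rw [lintegral_const_mul' _ _ ENNReal.ofReal_ne_top]
        congr 1
        exact lintegral_indicator_one (isOpen_lt_maximalFunction f _).measurableSet
    _ ≤ ∫⁻ t in Set.Ioi (0 : ℝ), (K * Real.toNNReal (p / (p - 1)) : ℝ≥0) *
          (ENNReal.ofReal ((p - 1) * t ^ (p - 1 - 1)) *
            ∫⁻ x, {x | ENNReal.ofReal t < 2 * f x}.indicator f x ∂μ) :=
        setLIntegral_mono_ae' measurableSet_Ioi (Filter.Eventually.of_forall hpt)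
    _ = (K * Real.toNNReal (p / (p - 1)) : ℝ≥0) * ∫⁻ t in Set.Ioi (0 : ℝ), ∫⁻ x,
          f x * (ENNReal.ofReal ((p - 1) * t ^ (p - 1 - 1)) *
            {t : ℝ | ENNReal.ofReal t < 2 * f x}.indicator 1 t) ∂μ := by
        rw [lintegral_const_mul' _ _ ENNReal.coe_ne_top]
        congr 1
        refine lintegral_congr fun t => ?_
        rw [← lintegral_const_mul' _ _ ENNReal.ofReal_ne_top]
        refine lintegral_congr fun x => ?_
        by_cases h : ENNReal.ofReal t < 2 * f x
        · rw [Set.indicator_of_mem (by exact h), Set.indicator_of_mem (by exact h)]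
          simp [mul_comm]
        · rw [Set.indicator_of_notMem (by exact h), Set.indicator_of_notMem (by exact h)]
          simp
    _ = (K * Real.toNNReal (p / (p - 1)) : ℝ≥0) * ∫⁻ x, (∫⁻ t in Set.Ioi (0 : ℝ),
          f x * (ENNReal.ofReal ((p - 1) * t ^ (p - 1 - 1)) *
            {t : ℝ | ENNReal.ofReal t < 2 * f x}.indicator 1 t)) ∂μ := by
        congr 1
        refine (lintegral_lintegral_swap (Measurable.aemeasurable ?_)).symm
        exact (hf.comp measurable_fst).mul (((hpow (p - 1)).comp measurable_snd).mul
          ((measurable_one.indicator hset2 : Measurable ({z : E × ℝ |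
            ENNReal.ofReal z.2 < 2 * f z.1}.indicator (1 : E × ℝ → ℝ≥0∞)))))
    _ = (K * Real.toNNReal (p / (p - 1)) : ℝ≥0) * ∫⁻ x, f x * (2 * f x) ^ (p - 1) ∂μ := by
        congr 1
        refine lintegral_congr fun x => ?_
        rw [lintegral_const_mul, ← rpow_eq_lintegral_indicator hp1]
        exact (hpow (p - 1)).mul (measurable_one.indicator
          (measurableSet_lt (by fun_prop) measurable_const))
    _ = _ := by
        rw [ENNReal.coe_mul _ (Real.toNNReal (2 ^ (p - 1))),
          mul_assoc (ENNReal.ofNNReal (K * _))]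
        congr 1
        rw [← lintegral_const_mul' _ _ ENNReal.coe_ne_top]
        refine lintegral_congr fun x => ?_
        rw [ENNReal.mul_rpow_of_nonneg _ _ hp1.le, mul_left_comm]
        congr 1
        · rw [← ENNReal.ofReal, ← ENNReal.ofReal_rpow_of_pos (by norm_num)]; simp
        · conv_rhs => rw [show p = 1 + (p - 1) by ring,
            ENNReal.rpow_add_of_nonneg _ _ zero_le_one hp1.le, ENNReal.rpow_one]

end MaximalFunction

/-! ### Riesz potentials and the Hardy–Littlewood–Sobolev inequality -/

section RieszPotential

theorem lintegral_ball_le_rpow {E : Type*} [PseudoMetricSpace E] [MeasurableSpace E]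
    {μ : Measure E} {p : ℝ} (hp : 1 < p) {f : E → ℝ≥0∞} (hf : Measurable f)
    (x : E) (t : ℝ) :
    ∫⁻ z in ball x t, f z ∂μ ≤ (∫⁻ z, f z ^ p ∂μ) ^ (1 / p) * μ (ball x t) ^ (1 - 1 / p) := by
  have hpq := Real.HolderConjugate.conjExponent hp
  have h := ENNReal.lintegral_mul_le_Lp_mul_Lq (μ.restrict (ball x t)) hpq hf.aemeasurable
    (aemeasurable_const (b := (1 : ℝ≥0∞)))
  simp only [Pi.mul_apply, mul_one, ENNReal.one_rpow, lintegral_const, one_mul,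
    Measure.restrict_apply_univ] at h
  have e : 1 / p.conjExponent = 1 - 1 / p := by
    have := hpq.inv_add_inv_eq_one
    rw [one_div, one_div]; linarith
  rw [e] at h
  refine h.trans ?_
  gcongr
  exact Measure.restrict_le_self

variable {E : Type*} [NormedAddCommGroup E] [MeasurableSpace E] [NormedSpace ℝ E]

/-- The Riesz potential `∫ f(z) |x - z|^(β - d) dz` of order `β`, where `d = dim E`, without a
normalising constant. -/
noncomputable def rieszPotential (μ : Measure E) (β : ℝ) (f : E → ℝ≥0∞) (x : E) : ℝ≥0∞ :=
  ∫⁻ z, f z * ‖x - z‖ₑ ^ (β - finrank ℝ E) ∂μ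

theorem rieszPotential_congr_ae {μ : Measure E} {β : ℝ} {f g : E → ℝ≥0∞} (h : f =ᵐ[μ] g) :
    rieszPotential μ β f = rieszPotential μ β g := by
  funext x
  refine lintegral_congr_ae ?_
  filter_upwards [h] with z hz
  rw [hz]

theorem rieszPotential_mono {μ : Measure E} {β : ℝ} {f g : E → ℝ≥0∞} (h : ∀ z, f z ≤ g z)
    (x : E) : rieszPotential μ β f x ≤ rieszPotential μ β g x :=
  lintegral_mono fun z => mul_le_mul_left (h z) _

variable {μ : Measure E} [FiniteDimensional ℝ E] [BorelSpace E] [μ.IsAddHaarMeasure]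

theorem measurable_rieszPotential (β : ℝ) {f : E → ℝ≥0∞} (hf : AEMeasurable f μ) :
    Measurable (rieszPotential μ β f) := by
  rw [rieszPotential_congr_ae hf.ae_eq_mk]
  refine Measurable.lintegral_prod_right' (ν := μ)
    (f := fun q : E × E => hf.mk f q.2 * ‖q.1 - q.2‖ₑ ^ (β - finrank ℝ E)) ?_
  fun_prop

/-- The Riesz potential is an average of integrals over concentric balls. -/
theorem rieszPotential_eq_lintegral_ball [Nontrivial E] {β : ℝ} (hβ : β < finrank ℝ E)
    {f : E → ℝ≥0∞} (hf : Measurable f) (x : E) :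
    rieszPotential μ β f x = ∫⁻ t in Set.Ioi (0 : ℝ),
      ENNReal.ofReal ((finrank ℝ E - β) * t ^ (-(finrank ℝ E - β) - 1)) *
        ∫⁻ z in ball x t, f z ∂μ := by
  set s : ℝ := finrank ℝ E - β with hs_def
  have hs : 0 < s := sub_pos.2 hβ
  have hker : ∀ z, z ≠ x → ‖x - z‖ₑ ^ (β - finrank ℝ E) = ∫⁻ t in Set.Ioi (0 : ℝ),
      ENNReal.ofReal (s * t ^ (-s - 1)) * {t : ℝ | dist z x < t}.indicator 1 t := by
    intro z hz
    have hzx : 0 < ‖x - z‖ := norm_pos_iff.2 (sub_ne_zero.2 hz.symm)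
    rw [show β - finrank ℝ E = -s by rw [hs_def]; ring, ← ofReal_norm,
      ENNReal.ofReal_rpow_of_pos hzx, ← lintegral_Ioi_rpow hs hzx,
      ← lintegral_indicator measurableSet_Ioi, ← lintegral_indicator measurableSet_Ioi]
    refine lintegral_congr fun t => ?_
    have hd : dist z x = ‖x - z‖ := by rw [dist_comm, dist_eq_norm]
    by_cases ht : ‖x - z‖ < t
    · rw [Set.indicator_of_mem (by exact ht), Set.indicator_of_mem (by exact hzx.trans ht),
        Set.indicator_of_mem (by rw [← hd] at ht; exact ht)]
      simp
    · rw [Set.indicator_of_notMem (by exact ht)]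
      by_cases h0 : 0 < t
      · rw [Set.indicator_of_mem (by exact h0),
          Set.indicator_of_notMem (by rw [← hd] at ht; exact ht)]
        simp
      · rw [Set.indicator_of_notMem (by exact h0)]
  have hset : MeasurableSet {q : E × ℝ | dist q.1 x < q.2} :=
    measurableSet_lt (by fun_prop) (by fun_prop)
  calc rieszPotential μ β f x
      = ∫⁻ z, (∫⁻ t in Set.Ioi (0 : ℝ), f z * (ENNReal.ofReal (s * t ^ (-s - 1)) *
          {t : ℝ | dist z x < t}.indicator 1 t)) ∂μ := by
        refine lintegral_congr_ae ?_
        filter_upwards [Measure.ae_ne μ x] with z hz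
        rw [hker z hz, lintegral_const_mul]
        exact Measurable.mul (by fun_prop) (measurable_one.indicator
          (measurableSet_lt measurable_const measurable_id))
    _ = ∫⁻ t in Set.Ioi (0 : ℝ), ∫⁻ z, f z * (ENNReal.ofReal (s * t ^ (-s - 1)) *
          {t : ℝ | dist z x < t}.indicator 1 t) ∂μ := by
        refine lintegral_lintegral_swap (Measurable.aemeasurable ?_)
        exact (hf.comp measurable_fst).mul (Measurable.mul (by fun_prop)
          ((measurable_one.indicator hset : Measurable ({q : E × ℝ |
            dist q.1 x < q.2}.indicator (1 : E × ℝ → ℝ≥0∞)))))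
    _ = _ := by
        refine lintegral_congr fun t => ?_
        rw [← lintegral_const_mul' _ _ ENNReal.ofReal_ne_top,
          ← lintegral_indicator measurableSet_ball]
        refine lintegral_congr fun z => ?_
        by_cases h : dist z x < t
        · rw [Set.indicator_of_mem (by exact h), Set.indicator_of_mem (by exact h)]
          simp [mul_comm]
        · rw [Set.indicator_of_notMem (by exact h), Set.indicator_of_notMem (by exact h)]
          simp

/-- Splitting the Riesz potential at the radius `δ`: the near part is controlled by the maximal
function, the far part by the `L^p` norm. -/
theorem rieszPotential_le_split [Nontrivial E] {β p : ℝ} (hp : 1 < p) (hβ : 0 < β)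
    (hβp : β * p < finrank ℝ E) :
    ∃ C : ℝ≥0, ∀ f : E → ℝ≥0∞, Measurable f → ∀ x, ∀ δ : ℝ, 0 < δ →
      rieszPotential μ β f x ≤ C * (maximalFunction μ f x * ENNReal.ofReal (δ ^ β) +
        (∫⁻ z, f z ^ p ∂μ) ^ (1 / p) * ENNReal.ofReal (δ ^ (β - finrank ℝ E / p))) := by
  set d : ℝ := ((finrank ℝ E : ℕ) : ℝ) with hd
  have hp0 : 0 < p := by linarith
  have hβd : β < d := lt_of_le_of_lt (by nlinarith) hβp
  have hg : 0 < d / p - β := by rw [sub_pos, lt_div_iff₀ hp0]; exact hβp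
  obtain ⟨V, hV⟩ : ∃ V : ℝ≥0, μ (ball (0 : E) 1) = V :=
    ⟨_, (ENNReal.coe_toNNReal measure_ball_lt_top.ne).symm⟩
  have hball : ∀ (x : E) (t : ℝ), 0 < t → μ (ball x t) = ENNReal.ofReal (t ^ d) * V := by
    intro x t ht
    rw [Measure.addHaar_ball_of_pos μ x ht, hV, hd, Real.rpow_natCast]
  have h1p : 0 ≤ 1 - 1 / p := by
    rw [sub_nonneg, div_le_one hp0]; exact hp.le
  obtain ⟨W, hW⟩ : ∃ W : ℝ≥0, (V : ℝ≥0∞) ^ (1 - 1 / p) = W :=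
    ⟨V ^ (1 - 1 / p), (ENNReal.coe_rpow_of_nonneg _ h1p).symm⟩
  set A : ℝ≥0 := V * Real.toNNReal ((d - β) / β) with hA
  set B : ℝ≥0 := W * Real.toNNReal ((d - β) / (d / p - β)) with hB
  refine ⟨A + B, fun f hf x δ hδ => ?_⟩
  set M := maximalFunction μ f x
  set N := (∫⁻ z, f z ^ p ∂μ) ^ (1 / p)
  have hnear : ∫⁻ t in Set.Ioo 0 δ, ENNReal.ofReal ((d - β) * t ^ (-(d - β) - 1)) *
      ∫⁻ z in ball x t, f z ∂μ ≤ A * (M * ENNReal.ofReal (δ ^ β)) := by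
    calc _ ≤ ∫⁻ t in Set.Ioo 0 δ, (A * M) * ENNReal.ofReal (β * t ^ (β - 1)) := by
          refine setLIntegral_mono_ae' measurableSet_Ioo (Filter.Eventually.of_forall fun t ht => ?_)
          have ht0 : 0 < t := ht.1
          refine (mul_le_mul_right (lintegral_ball_le_maximalFunction f x ht0) _).trans_eq ?_
          rw [hball x t ht0, ← mul_assoc, ← mul_assoc, ← ENNReal.ofReal_mul (by positivity)]
          have e : (d - β) * t ^ (-(d - β) - 1) * t ^ d = (d - β) / β * (β * t ^ (β - 1)) := by
            rw [mul_assoc, ← Real.rpow_add ht0, show -(d - β) - 1 + d = β - 1 by ring]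
            field_simp
          rw [e, ENNReal.ofReal_mul (by positivity), hA, ENNReal.coe_mul, ← ENNReal.ofReal]
          ring
      _ = _ := by
          rw [lintegral_const_mul _ (by fun_prop), lintegral_Ioo_rpow hβ hδ.le, mul_assoc]
  have hfar : ∫⁻ t in Set.Ici δ, ENNReal.ofReal ((d - β) * t ^ (-(d - β) - 1)) *
      ∫⁻ z in ball x t, f z ∂μ ≤ B * (N * ENNReal.ofReal (δ ^ (β - d / p))) := by
    rw [← setLIntegral_congr Ioi_ae_eq_Ici]
    calc _ ≤ ∫⁻ t in Set.Ioi δ, (B * N) *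
          ENNReal.ofReal ((d / p - β) * t ^ (-(d / p - β) - 1)) := by
          refine setLIntegral_mono_ae' measurableSet_Ioi (Filter.Eventually.of_forall fun t ht => ?_)
          have ht0 : 0 < t := hδ.trans ht
          refine (mul_le_mul_right (lintegral_ball_le_rpow hp hf x t) _).trans_eq ?_
          rw [hball x t ht0, ENNReal.mul_rpow_of_nonneg _ _ h1p, hW,
            ENNReal.ofReal_rpow_of_nonneg (by positivity) h1p, ← Real.rpow_mul ht0.le]
          have e : (d - β) * t ^ (-(d - β) - 1) * t ^ (d * (1 - 1 / p)) =
              (d - β) / (d / p - β) * ((d / p - β) * t ^ (-(d / p - β) - 1)) := by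
            rw [mul_assoc, ← Real.rpow_add ht0,
              show -(d - β) - 1 + d * (1 - 1 / p) = -(d / p - β) - 1 by ring,
              ← mul_assoc (_ / _), div_mul_cancel₀ _ hg.ne']
          calc _ = ENNReal.ofReal ((d - β) * t ^ (-(d - β) - 1)) *
                ENNReal.ofReal (t ^ (d * (1 - 1 / p))) * (N * W) := by ring
            _ = _ := by
                rw [← ENNReal.ofReal_mul (by positivity), e, ENNReal.ofReal_mul (by positivity),
                  hB, ENNReal.coe_mul, ← ENNReal.ofReal]
                ring
      _ = _ := by
          rw [lintegral_const_mul _ (by fun_prop), lintegral_Ioi_rpow hg hδ, neg_sub, mul_assoc]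
  rw [rieszPotential_eq_lintegral_ball hβd hf, ← Set.Ioo_union_Ici_eq_Ioi hδ]
  refine (lintegral_union_le _ _ _).trans ((add_le_add hnear hfar).trans ?_)
  rw [ENNReal.coe_add, mul_add]
  gcongr
  · exact le_self_add
  · exact le_add_self

/-- Hedberg's inequality: optimising the splitting radius bounds the Riesz potential pointwise by a
geometric mean of the maximal function and the `L^p` norm. -/
theorem rieszPotential_le_maximalFunction [Nontrivial E] {β p : ℝ} (hp : 1 < p) (hβ : 0 < β)
    (hβp : β * p < finrank ℝ E) :
    ∃ C : ℝ≥0, ∀ f : E → ℝ≥0∞, Measurable f → ∀ x,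
      rieszPotential μ β f x ≤ C * (((∫⁻ z, f z ^ p ∂μ) ^ (1 / p)) ^ (β * p / finrank ℝ E) *
        maximalFunction μ f x ^ (1 - β * p / finrank ℝ E)) := by
  obtain ⟨C, hC⟩ := rieszPotential_le_split (μ := μ) hp hβ hβp
  have hd0 : 0 < (finrank ℝ E : ℝ) := by exact_mod_cast Module.finrank_pos
  set d : ℝ := ((finrank ℝ E : ℕ) : ℝ) with hd
  have hβd : β < d := lt_of_le_of_lt (by nlinarith) hβp
  have hθ0 : 0 < β * p / d := by positivity
  have hθ1 : 0 < 1 - β * p / d := by rw [sub_pos, div_lt_one hd0]; exact hβp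
  refine ⟨2 * C + 1, fun f hf x => ?_⟩
  specialize hC f hf x
  have hzero : (∀ t : ℝ, 0 < t → ∫⁻ z in ball x t, f z ∂μ = 0) →
      rieszPotential μ β f x = 0 := by
    intro h
    rw [rieszPotential_eq_lintegral_ball hβd hf, setLIntegral_congr_fun measurableSet_Ioi
      (g := fun _ => 0) fun t ht => by rw [h t ht, mul_zero]]
    simp
  set M := maximalFunction μ f x with hM
  set N := (∫⁻ z, f z ^ p ∂μ) ^ (1 / p) with hN
  rcases eq_or_ne M 0 with hM0 | hM0
  · rw [hzero fun t ht => ?_]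
    · exact zero_le
    · have := lintegral_ball_le_maximalFunction (μ := μ) f x ht
      rw [← hM, hM0, mul_zero] at this
      exact le_zero_iff.1 this
  rcases eq_or_ne N 0 with hN0 | hN0
  · rw [hzero fun t ht => ?_]
    · exact zero_le
    · have := lintegral_ball_le_rpow (μ := μ) hp hf x t
      rw [← hN, hN0, zero_mul] at this
      exact le_zero_iff.1 this
  have hC0 : ((2 * C + 1 : ℝ≥0) : ℝ≥0∞) ≠ 0 := by
    rw [ENNReal.coe_ne_zero]; positivity
  rcases eq_or_ne M ⊤ with hMt | hMt
  · rw [hMt, ENNReal.top_rpow_of_pos hθ1, ENNReal.mul_top, ENNReal.mul_top hC0]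
    · exact le_top
    · simp [ENNReal.rpow_eq_zero_iff, hN0, hθ0.le]
  rcases eq_or_ne N ⊤ with hNt | hNt
  · rw [hNt, ENNReal.top_rpow_of_pos hθ0, ENNReal.top_mul, ENNReal.mul_top hC0]
    · exact le_top
    · simp [ENNReal.rpow_eq_zero_iff, hM0, hMt]
  -- both quantities are finite and positive, so the optimal radius is available
  have hm : 0 < M.toReal := ENNReal.toReal_pos hM0 hMt
  have hn : 0 < N.toReal := ENNReal.toReal_pos hN0 hNt
  have hMe : M = ENNReal.ofReal M.toReal := (ENNReal.ofReal_toReal hMt).symm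
  have hNe : N = ENNReal.ofReal N.toReal := (ENNReal.ofReal_toReal hNt).symm
  generalize M.toReal = m at hm hMe
  generalize N.toReal = k at hn hNe
  have h := hC ((k / m) ^ (p / d)) (by positivity)
  rw [hMe, hNe, ← Real.rpow_mul (by positivity), ← Real.rpow_mul (by positivity),
    ← ENNReal.ofReal_mul hm.le, ← ENNReal.ofReal_mul hn.le, Real.div_rpow hn.le hm.le,
    Real.div_rpow hn.le hm.le] at h
  have e1 : m * (k ^ (p / d * β) / m ^ (p / d * β)) = k ^ (β * p / d) * m ^ (1 - β * p / d) := by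
    rw [Real.rpow_sub hm, Real.rpow_one, show p / d * β = β * p / d by ring]; ring
  have e2 : k * (k ^ (p / d * (β - d / p)) / m ^ (p / d * (β - d / p))) =
      k ^ (β * p / d) * m ^ (1 - β * p / d) := by
    rw [show p / d * (β - d / p) = -(1 - β * p / d) by field_simp; ring, Real.rpow_neg hm.le,
      div_inv_eq_mul, neg_sub, Real.rpow_sub hn, Real.rpow_one]
    field_simp
  rw [e1, e2, ENNReal.ofReal_mul (by positivity), ← ENNReal.ofReal_rpow_of_pos hn,
    ← ENNReal.ofReal_rpow_of_pos hm, ← hMe, ← hNe] at h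
  refine h.trans ?_
  rw [← two_mul, ← mul_assoc, mul_comm (C : ℝ≥0∞)]
  gcongr
  push_cast
  exact le_self_add

/-- The Hardy–Littlewood–Sobolev inequality: the Riesz potential of order `β` maps `L^p` to `L^r`
if `p > 1` and `1 / r = 1 / p - β / d > 0`. -/
theorem lintegral_rieszPotential_rpow_le [Nontrivial E] {β p r : ℝ} (hp : 1 < p) (hβ : 0 < β)
    (hr : 0 < r) (hrp : 1 / r = 1 / p - β / finrank ℝ E) :
    ∃ C : ℝ≥0, ∀ f : E → ℝ≥0∞, AEMeasurable f μ →
      (∫⁻ x, rieszPotential μ β f x ^ r ∂μ) ^ (1 / r) ≤ C * (∫⁻ x, f x ^ p ∂μ) ^ (1 / p) := by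
  suffices H : ∃ C : ℝ≥0, ∀ f : E → ℝ≥0∞, Measurable f →
      (∫⁻ x, rieszPotential μ β f x ^ r ∂μ) ^ (1 / r) ≤ C * (∫⁻ x, f x ^ p ∂μ) ^ (1 / p) by
    obtain ⟨C, hC⟩ := H
    refine ⟨C, fun f hf => ?_⟩
    have h := hC _ hf.measurable_mk
    rwa [← rieszPotential_congr_ae hf.ae_eq_mk,
      ← lintegral_congr_ae (hf.ae_eq_mk.mono fun x hx => congrArg (· ^ p) hx)] at h
  have hd0 : 0 < (finrank ℝ E : ℝ) := by exact_mod_cast Module.finrank_pos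
  have hp0 : 0 < p := by linarith
  have hr0 : 0 < 1 / r := by positivity
  have hθ : 1 - β * p / finrank ℝ E = p * (1 / r) := by rw [hrp]; field_simp
  have hβp : β * p < finrank ℝ E := by
    have : 0 < 1 - β * p / finrank ℝ E := by rw [hθ]; positivity
    rwa [sub_pos, div_lt_one hd0] at this
  obtain ⟨C, hC⟩ := rieszPotential_le_maximalFunction (μ := μ) hp hβ hβp
  obtain ⟨D, hD⟩ := lintegral_maximalFunction_rpow_le (μ := μ) hp
  refine ⟨C * D ^ (1 / r), fun f hf => ?_⟩
  specialize hC f hf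
  set N := (∫⁻ z, f z ^ p ∂μ) ^ (1 / p) with hN
  have hNp : ∫⁻ z, f z ^ p ∂μ = N ^ p := by
    rw [hN, ← ENNReal.rpow_mul, one_div_mul_cancel hp0.ne', ENNReal.rpow_one]
  clear_value N
  set θ := β * p / (finrank ℝ E : ℝ) with hθ_def
  have hθ0 : 0 < θ := by positivity
  calc (∫⁻ x, rieszPotential μ β f x ^ r ∂μ) ^ (1 / r)
      ≤ (∫⁻ x, (C * N ^ θ) ^ r * maximalFunction μ f x ^ p ∂μ) ^ (1 / r) := by
        refine ENNReal.rpow_le_rpow (lintegral_mono fun x => ?_) hr0.le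
        refine (ENNReal.rpow_le_rpow (hC x) hr.le).trans_eq ?_
        rw [← mul_assoc, ENNReal.mul_rpow_of_nonneg _ _ hr.le, ← ENNReal.rpow_mul, hθ, mul_assoc,
          one_div_mul_cancel hr.ne', mul_one]
    _ ≤ ((C * N ^ θ) ^ r * (D * N ^ p)) ^ (1 / r) := by
        rw [lintegral_const_mul _ ((measurable_maximalFunction f).pow_const p)]
        gcongr
        rw [← hNp]
        exact hD f hf.aemeasurable
    _ = _ := by
        rw [ENNReal.mul_rpow_of_nonneg _ _ hr0.le, ENNReal.mul_rpow_of_nonneg _ _ hr0.le,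
          ← ENNReal.rpow_mul, mul_one_div_cancel hr.ne', ENNReal.rpow_one, ← ENNReal.rpow_mul,
          ENNReal.coe_mul, ENNReal.coe_rpow_of_nonneg _ hr0.le, ← hθ]
        calc _ = C * (D : ℝ≥0∞) ^ (1 / r) * (N ^ θ * N ^ (1 - θ)) := by ring
          _ = _ := by
            rw [← ENNReal.rpow_add_of_nonneg _ _ hθ0.le (by rw [hθ]; positivity),
              add_sub_cancel, ENNReal.rpow_one]

end RieszPotential

/-! ### The potential estimate for `C¹` functions -/

section Segments

variable {E : Type*} [NormedAddCommGroup E] [NormedSpace ℝ E]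

theorem enorm_sub_le_lintegral_segment {v : E → ℝ} (hv : ContDiff ℝ 1 v) (x y : E) :
    ‖v x - v y‖ₑ ≤ ∫⁻ t in Set.Ioo (0 : ℝ) 1, ‖fderiv ℝ v (x + t • (y - x))‖ₑ * ‖y - x‖ₑ := by
  set γ : ℝ → E := fun t => x + t • (y - x)
  have hγ : ContDiff ℝ 1 γ := by fun_prop
  have h := enorm_sub_le_lintegral_deriv_of_contDiffOn_Icc (f := v ∘ γ) (a := 0) (b := 1)
    (hv.comp hγ).contDiffOn zero_le_one
  have e0 : (v ∘ γ) 0 = v x := by simp [γ]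
  have e1 : (v ∘ γ) 1 = v y := by simp [γ]
  rw [e0, e1, enorm_sub_rev, ← restrict_Ioo_eq_restrict_Icc] at h
  refine h.trans (lintegral_mono fun t => ?_)
  have hγ' : HasDerivAt γ (y - x) t := by
    simpa [γ] using ((hasDerivAt_id t).smul_const (y - x)).const_add x
  have hd := ((hv.differentiable one_ne_zero).differentiableAt (x := γ t)).hasFDerivAt.comp_hasDerivAt
    t hγ'
  rw [hd.deriv]
  exact ContinuousLinearMap.le_opENorm _ _

variable [MeasurableSpace E] {μ : Measure E} [FiniteDimensional ℝ E] [BorelSpace E]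
  [μ.IsAddHaarMeasure]

theorem lintegral_comp_add_smul_sub (f : E → ℝ≥0∞) (x : E) {t : ℝ} (ht : 0 < t) :
    ∫⁻ y, f (x + t • (y - x)) ∂μ = ENNReal.ofReal (t ^ (-(finrank ℝ E : ℝ))) * ∫⁻ z, f z ∂μ := by
  have h1 : ∫⁻ y, f (x + t • (y - x)) ∂μ = ∫⁻ y, f (x + t • y) ∂μ :=
    lintegral_sub_right_eq_self (fun y => f (x + t • y)) x
  have h2 : ∫⁻ z, f (x + z) ∂μ = ∫⁻ z, f z ∂μ := lintegral_add_left_eq_self f x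
  have h3 : ∫⁻ y, f (x + t • y) ∂μ = ∫⁻ z, f (x + z) ∂(Measure.map (t • ·) μ) :=
    ((Homeomorph.smulOfNeZero t ht.ne').toMeasurableEquiv.measurableEmbedding.lintegral_map
      (fun z => f (x + z))).symm
  rw [h1, h3, Measure.map_addHaar_smul μ ht.ne', lintegral_smul_measure, h2, smul_eq_mul,
    Real.rpow_neg ht.le, Real.rpow_natCast, abs_of_pos (by positivity)]

/-- The potential estimate for `C¹` functions on a ball. Integrating the derivative along segments
and substituting `z = x + t (y - x)` for fixed `t` leaves, for each `z`, the parameters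
`t > |z - x| / (2 R)`, whose contribution is a multiple of `|z - x|^(-d)`. -/
theorem lintegral_enorm_sub_le_rieszPotential_of_contDiff [Nontrivial E] {v : E → ℝ}
    (hv : ContDiff ℝ 1 v) (x₀ : E) {R : ℝ} (hR : 0 < R) {x : E} (hx : x ∈ ball x₀ R) :
    ∫⁻ y in ball x₀ R, ‖v x - v y‖ₑ ∂μ ≤
      ENNReal.ofReal ((2 * R) ^ (finrank ℝ E : ℝ)) *
        rieszPotential μ 1 ((ball x₀ R).indicator fun z => ‖fderiv ℝ v z‖ₑ) x := by
  set d : ℝ := ((finrank ℝ E : ℕ) : ℝ) with hd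
  have hd0 : 0 < d := by rw [hd]; exact_mod_cast Module.finrank_pos
  have hd1 : 1 ≤ d := by rw [hd]; exact_mod_cast Nat.succ_le_of_lt Module.finrank_pos
  have hG : Measurable fun z => ‖fderiv ℝ v z‖ₑ :=
    (hv.continuous_fderiv one_ne_zero).enorm.measurable
  set G : E → ℝ≥0∞ := (ball x₀ R).indicator fun z => ‖fderiv ℝ v z‖ₑ with hGdef
  have hGm : Measurable G := hG.indicator measurableSet_ball
  -- the integrand after the substitution
  set F : ℝ → E → ℝ≥0∞ := fun t z => G z * ‖x - z‖ₑ * ENNReal.ofReal t⁻¹ *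
    {t : ℝ | ‖x - z‖ / (2 * R) < t}.indicator 1 t with hF
  have hset : MeasurableSet {q : E × ℝ | ‖x - q.1‖ / (2 * R) < q.2} :=
    measurableSet_lt (by fun_prop) (by fun_prop)
  have hFm : Measurable fun q : E × ℝ => F q.2 q.1 :=
    (((hGm.comp measurable_fst).mul (by fun_prop)).mul (by fun_prop)).mul
      ((measurable_one.indicator hset : Measurable ({q : E × ℝ |
        ‖x - q.1‖ / (2 * R) < q.2}.indicator (1 : E × ℝ → ℝ≥0∞))))
  have hpt : ∀ y ∈ ball x₀ R, ∀ t ∈ Set.Ioo (0 : ℝ) 1,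
      ‖fderiv ℝ v (x + t • (y - x))‖ₑ * ‖y - x‖ₑ ≤ F t (x + t • (y - x)) := by
    intro y hy t ht
    have hz : x + t • (y - x) ∈ ball x₀ R :=
      (convex_ball x₀ R).add_smul_sub_mem hx hy ⟨ht.1.le, ht.2.le⟩
    have hxy : ‖y - x‖ < 2 * R := by
      rw [← dist_eq_norm]
      have := dist_triangle_right y x x₀
      rw [mem_ball] at hx hy
      linarith
    have hn : ‖x - (x + t • (y - x))‖ = t * ‖y - x‖ := by
      rw [sub_add_cancel_left, norm_neg, norm_smul, Real.norm_of_nonneg ht.1.le]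
    have hlt : ‖x - (x + t • (y - x))‖ / (2 * R) < t := by
      rw [hn, div_lt_iff₀ (by positivity)]
      exact mul_lt_mul_of_pos_left hxy ht.1
    simp only [hF, hGdef]
    rw [Set.indicator_of_mem hz, Set.indicator_of_mem (by exact hlt), Pi.one_apply, mul_one,
      mul_assoc]
    gcongr
    rw [← ofReal_norm (x - _), hn, ← ENNReal.ofReal_mul (by have := ht.1; positivity),
      mul_comm t, mul_inv_cancel_right₀ ht.1.ne', ofReal_norm]
  have hint : ∀ t ∈ Set.Ioo (0 : ℝ) 1,
      ∫⁻ y in ball x₀ R, ‖fderiv ℝ v (x + t • (y - x))‖ₑ * ‖y - x‖ₑ ∂μ ≤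
        ENNReal.ofReal (t ^ (-d)) * ∫⁻ z, F t z ∂μ := by
    intro t ht
    calc _ ≤ ∫⁻ y in ball x₀ R, F t (x + t • (y - x)) ∂μ :=
          setLIntegral_mono_ae' measurableSet_ball
            (Filter.Eventually.of_forall fun y hy => hpt y hy t ht)
      _ ≤ ∫⁻ y, F t (x + t • (y - x)) ∂μ := setLIntegral_le_lintegral _ _
      _ = _ := lintegral_comp_add_smul_sub _ x ht.1
  calc ∫⁻ y in ball x₀ R, ‖v x - v y‖ₑ ∂μ
      ≤ ∫⁻ y in ball x₀ R, (∫⁻ t in Set.Ioo (0 : ℝ) 1,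
          ‖fderiv ℝ v (x + t • (y - x))‖ₑ * ‖y - x‖ₑ) ∂μ :=
        lintegral_mono fun y => enorm_sub_le_lintegral_segment hv x y
    _ = ∫⁻ t in Set.Ioo (0 : ℝ) 1, ∫⁻ y in ball x₀ R,
          ‖fderiv ℝ v (x + t • (y - x))‖ₑ * ‖y - x‖ₑ ∂μ := by
        refine lintegral_lintegral_swap (Measurable.aemeasurable ?_)
        refine (hG.comp (g := fun z => ‖fderiv ℝ v z‖ₑ)
          (f := fun q : E × ℝ => x + q.2 • (q.1 - x)) ?_).mul ?_ <;> fun_prop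
    _ ≤ ∫⁻ t in Set.Ioo (0 : ℝ) 1, ENNReal.ofReal (t ^ (-d)) * ∫⁻ z, F t z ∂μ :=
        setLIntegral_mono_ae' measurableSet_Ioo (Filter.Eventually.of_forall hint)
    _ ≤ ∫⁻ t in Set.Ioi (0 : ℝ), ENNReal.ofReal (t ^ (-d)) * ∫⁻ z, F t z ∂μ :=
        lintegral_mono_set fun t ht => ht.1
    _ = ∫⁻ t in Set.Ioi (0 : ℝ), ∫⁻ z, ENNReal.ofReal (t ^ (-d)) * F t z ∂μ := by
        simp_rw [lintegral_const_mul' _ _ ENNReal.ofReal_ne_top]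
    _ = ∫⁻ z, (∫⁻ t in Set.Ioi (0 : ℝ), ENNReal.ofReal (t ^ (-d)) * F t z) ∂μ := by
        refine (lintegral_lintegral_swap (Measurable.aemeasurable ?_)).symm
        exact Measurable.mul (by fun_prop) hFm
    _ ≤ ∫⁻ z, ENNReal.ofReal ((2 * R) ^ d) * (G z * ‖x - z‖ₑ ^ (1 - d)) ∂μ := by
        refine lintegral_mono_ae ?_
        filter_upwards [Measure.ae_ne μ x] with z hz
        have hzx : 0 < ‖x - z‖ := norm_pos_iff.2 (sub_ne_zero.2 hz.symm)
        have hb : 0 < ‖x - z‖ / (2 * R) := by positivity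
        calc ∫⁻ t in Set.Ioi (0 : ℝ), ENNReal.ofReal (t ^ (-d)) * F t z
            ≤ ∫⁻ t in Set.Ioi (‖x - z‖ / (2 * R)),
                G z * ‖x - z‖ₑ * ENNReal.ofReal (d * t ^ (-d - 1)) := by
              rw [← lintegral_indicator measurableSet_Ioi, ← lintegral_indicator measurableSet_Ioi]
              refine lintegral_mono fun t => ?_
              by_cases ht : ‖x - z‖ / (2 * R) < t
              · have ht0 : 0 < t := hb.trans ht
                rw [Set.indicator_of_mem (by exact ht0), Set.indicator_of_mem (by exact ht)]
                simp only [hF]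
                rw [Set.indicator_of_mem (by exact ht), Pi.one_apply, mul_one, mul_left_comm,
                  ← ENNReal.ofReal_mul (by positivity)]
                refine mul_le_mul_right (ENNReal.ofReal_le_ofReal ?_) _
                rw [Real.rpow_sub_one ht0.ne', div_eq_mul_inv]
                exact le_mul_of_one_le_left (by positivity) hd1
              · rw [Set.indicator_of_notMem (s := Set.Ioi (_ / _)) (by exact ht)]
                by_cases ht0 : 0 < t
                · rw [Set.indicator_of_mem (by exact ht0)]
                  simp only [hF]
                  rw [Set.indicator_of_notMem (by exact ht)]
                  simp
                · rw [Set.indicator_of_notMem (by exact ht0)]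
          _ = G z * ‖x - z‖ₑ * ENNReal.ofReal ((‖x - z‖ / (2 * R)) ^ (-d)) := by
              rw [lintegral_const_mul _ (by fun_prop), lintegral_Ioi_rpow hd0 hb]
          _ = _ := by
              rw [← ofReal_norm, ENNReal.ofReal_rpow_of_pos hzx, mul_assoc,
                mul_left_comm (ENNReal.ofReal ((2 * R) ^ d)), ← ENNReal.ofReal_mul (by positivity), ← ENNReal.ofReal_mul (by positivity)]
              congr 2
              rw [Real.div_rpow hzx.le (by positivity), Real.rpow_neg (by positivity : 0 ≤ 2 * R),
                div_inv_eq_mul, Real.rpow_sub hzx, Real.rpow_neg hzx.le, Real.rpow_one]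
              ring
    _ = _ := lintegral_const_mul' _ _ ENNReal.ofReal_ne_top

end Segments

/-! ### Mollification of weakly differentiable functions -/

section Mollification

/-- Mollifications are dominated by the maximal function, uniformly in the radius of the
mollifier. -/
theorem enorm_normed_convolution_le_maximalFunction {E F : Type*} [NormedAddCommGroup E]
    [NormedSpace ℝ E] [MeasurableSpace E] [BorelSpace E] [FiniteDimensional ℝ E] [Nontrivial E]
    {μ : Measure E} [μ.IsAddHaarMeasure] [NormedAddCommGroup F] [NormedSpace ℝ F] (φ : ContDiffBump (0 : E))
    {K : ℝ} (hφ : φ.rOut ≤ K * φ.rIn) (g : E → F) (x : E) :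
    ‖(φ.normed μ ⋆[ContinuousLinearMap.lsmul ℝ ℝ, μ] g) x‖ₑ ≤
      ENNReal.ofReal (K ^ finrank ℝ E) * maximalFunction μ (fun z => ‖g z‖ₑ) x := by
  set V := μ (ball x φ.rOut) with hV
  have hV0 : V ≠ 0 := (measure_ball_pos μ x φ.rOut_pos).ne'
  have hVt : V ≠ ⊤ := measure_ball_lt_top.ne
  have hVr : μ.real (closedBall (0 : E) φ.rOut) = V.toReal := by
    rw [Measure.real, Measure.addHaar_closedBall_eq_addHaar_ball, hV,
      Measure.addHaar_ball_center μ x]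
  have hV' : 0 < V.toReal := ENNReal.toReal_pos hV0 hVt
  rw [convolution_eq_swap]
  refine (enorm_integral_le_lintegral_enorm _).trans ?_
  calc ∫⁻ t, ‖ContinuousLinearMap.lsmul ℝ ℝ (φ.normed μ (x - t)) (g t)‖ₑ ∂μ
      ≤ ∫⁻ t, (ball x φ.rOut).indicator
          (fun t => ENNReal.ofReal (K ^ finrank ℝ E / V.toReal) * ‖g t‖ₑ) t ∂μ := by
        refine lintegral_mono fun t => ?_
        simp only [ContinuousLinearMap.lsmul_apply, enorm_smul]
        by_cases ht : t ∈ ball x φ.rOut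
        · rw [Set.indicator_of_mem ht]
          gcongr
          rw [Real.enorm_of_nonneg (φ.nonneg_normed _)]
          refine ENNReal.ofReal_le_ofReal ?_
          rw [← hVr]
          exact φ.normed_le_div_measure_closedBall_rOut μ K hφ _
        · have : φ.normed μ (x - t) = 0 := by
            rw [← Function.notMem_support, φ.support_normed_eq, mem_ball_zero_iff,
              ← dist_eq_norm, dist_comm]
            exact ht
          rw [this]
          simp
    _ = ENNReal.ofReal (K ^ finrank ℝ E) * (V⁻¹ * ∫⁻ t in ball x φ.rOut, ‖g t‖ₑ ∂μ) := by
        rw [lintegral_indicator measurableSet_ball, lintegral_const_mul' _ _ ENNReal.ofReal_ne_top,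
          ENNReal.ofReal_div_of_pos hV', ENNReal.ofReal_toReal hVt, div_eq_mul_inv, mul_assoc]
    _ ≤ _ := by
        gcongr
        exact le_iSup₂_of_le φ.rOut φ.rOut_pos le_rfl

/-- Mollification commutes with the weak gradient, at points whose distance to the complement of
`Ω` exceeds the radius of the mollifier. -/
theorem fderiv_normed_convolution_apply {n : ℕ} {Ω : Set (Rn n)} (hΩ : MeasurableSet Ω)
    {u : Rn n → ℝ} {Du : Rn n → Rn n} (h : HasWeakGradient Ω u Du) (hu : IntegrableOn u Ω)
    (hDu : IntegrableOn Du Ω) (φ : ContDiffBump (0 : Rn n)) {x : Rn n}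
    (hx : closedBall x φ.rOut ⊆ Ω) (i : Fin n) :
    fderiv ℝ (φ.normed volume ⋆[ContinuousLinearMap.lsmul ℝ ℝ, volume] Ω.indicator u) x
        (EuclideanSpace.single i 1) =
      (φ.normed volume ⋆[ContinuousLinearMap.lsmul ℝ ℝ, volume] Ω.indicator Du) x i := by
  have hφs : ContDiff ℝ ∞ (φ.normed (volume : Measure (Rn n))) := φ.contDiff_normed
  have hφ1 : ContDiff ℝ 1 (φ.normed (volume : Measure (Rn n))) := φ.contDiff_normed
  have hφc : HasCompactSupport (φ.normed (volume : Measure (Rn n))) := φ.hasCompactSupport_normed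
  have hU : Integrable (Ω.indicator u) := (integrable_indicator_iff hΩ).2 hu
  have hG : Integrable (Ω.indicator Du) := (integrable_indicator_iff hΩ).2 hDu
  set e : Rn n := EuclideanSpace.single i 1
  set ψ : Rn n → ℝ := fun s => φ.normed volume (x - s) with hψ
  have hψs : ContDiff ℝ ∞ ψ := hφs.comp (contDiff_const.sub contDiff_id)
  have hψt : tsupport ψ ⊆ closedBall x φ.rOut := by
    refine closure_minimal (fun s hs => ?_) isClosed_closedBall
    have : x - s ∈ Function.support (φ.normed (volume : Measure (Rn n))) := hs
    rw [φ.support_normed_eq, mem_ball_zero_iff, ← dist_eq_norm, dist_comm] at this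
    exact this.le
  have hψc : HasCompactSupport ψ :=
    (isCompact_closedBall x φ.rOut).of_isClosed_subset (isClosed_tsupport _) hψt
  have hψd : ∀ s, fderiv ℝ ψ s e = -fderiv ℝ (φ.normed volume) (x - s) e := by
    intro s
    have h1 : HasFDerivAt (fun s : Rn n => x - s) (-ContinuousLinearMap.id ℝ (Rn n)) s :=
      (hasFDerivAt_id s).const_sub x
    have h2 := (hφ1.differentiable one_ne_zero (x - s)).hasFDerivAt.comp s h1
    rw [show ψ = φ.normed volume ∘ fun s => x - s from rfl, h2.fderiv]
    simp
  have hφd : Continuous (fderiv ℝ (φ.normed (volume : Measure (Rn n)))) :=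
    hφ1.continuous_fderiv one_ne_zero
  have hex : ConvolutionExistsAt (fderiv ℝ (φ.normed (volume : Measure (Rn n)))) (Ω.indicator u) x
      ((ContinuousLinearMap.lsmul ℝ ℝ).precompL (Rn n)) volume :=
    hφc.fderiv (𝕜 := ℝ) |>.convolutionExists_left _ hφd hU.locallyIntegrable x
  have hexG : ConvolutionExistsAt (φ.normed (volume : Measure (Rn n))) (Ω.indicator Du) x
      (ContinuousLinearMap.lsmul ℝ ℝ) volume :=
    hφc.convolutionExists_left _ hφs.continuous hG.locallyIntegrable x
  rw [(hφc.hasFDerivAt_convolution_left _ hφ1 hU.locallyIntegrable x).fderiv]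
  have hL : ((fderiv ℝ (φ.normed volume) ⋆[(ContinuousLinearMap.lsmul ℝ ℝ).precompL (Rn n), volume]
      Ω.indicator u) x) e = ∫ s in Ω, u s * -fderiv ℝ ψ s e := by
    rw [convolution_eq_swap, ContinuousLinearMap.integral_apply hex.integrable_swap,
      ← integral_indicator hΩ]
    refine integral_congr_ae (Filter.Eventually.of_forall fun s => ?_)
    by_cases hs : s ∈ Ω
    · simp [ContinuousLinearMap.precompL_apply, hs, hψd, mul_comm]
    · simp [hs]
  have hR : (φ.normed volume ⋆[ContinuousLinearMap.lsmul ℝ ℝ, volume] Ω.indicator Du) x i =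
      ∫ s in Ω, Du s i * ψ s := by
    have := (EuclideanSpace.proj (𝕜 := ℝ) i : Rn n →L[ℝ] ℝ).integral_comp_comm
      hexG.integrable_swap
    rw [convolution_eq_swap, ← integral_indicator hΩ]
    refine Eq.trans this.symm (integral_congr_ae (Filter.Eventually.of_forall fun s => ?_))
    by_cases hs : s ∈ Ω
    · simp [hs, hψ, mul_comm]
    · simp [hs]
  rw [hL, hR]
  have := h.integral_eq ψ hψs hψc (hψt.trans hx) i
  simp only [mul_neg]
  rw [integral_neg, this, neg_neg]

theorem norm_le_norm_of_apply_single_eq {n : ℕ} {L : Rn n →L[ℝ] ℝ} {w : Rn n}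
    (h : ∀ i, L (EuclideanSpace.single i 1) = w i) : ‖L‖ ≤ ‖w‖ := by
  have hL : L = innerSL ℝ w := by
    refine ContinuousLinearMap.coe_injective
      ((EuclideanSpace.basisFun (Fin n) ℝ).toBasis.ext fun i => ?_)
    simp [h, EuclideanSpace.inner_single_right]
  rw [hL, innerSL_apply_norm]

end Mollification

/-! ### The potential estimate for Sobolev functions -/

section WeakGradient

/-- The potential estimate for Sobolev functions on a ball: at almost every point the mean
oscillation around `u x` is controlled by the Riesz potential of order one of the gradient. -/
theorem ae_lintegral_enorm_sub_le_rieszPotential {n : ℕ} {p : ℝ} (hp : 1 < p) (hpn : p < n)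
    {x₀ : Rn n} {R : ℝ} {u : Rn n → ℝ} {Du : Rn n → Rn n}
    (h : MemW1p p (ball x₀ R) u Du) :
    ∀ᵐ x ∂(volume.restrict (ball x₀ R)), ∫⁻ y in ball x₀ R, ‖u x - u y‖ₑ ≤
      ENNReal.ofReal ((2 * R) ^ (n : ℝ)) *
        rieszPotential volume 1 ((ball x₀ R).indicator fun z => ‖Du z‖ₑ) x := by
  have hn0 : (0 : ℝ) < n := by linarith
  have : Nonempty (Fin n) := Fin.pos_iff_nonempty.1 (by exact_mod_cast hn0)
  have hfin : finrank ℝ (Rn n) = n := by simp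
  have hp0 : 0 < p := by linarith
  have hp1 : (1 : ℝ≥0∞) ≤ ENNReal.ofReal p := by
    rw [← ENNReal.ofReal_one]; exact ENNReal.ofReal_le_ofReal hp.le
  set B := ball x₀ R with hB
  have hBm : MeasurableSet B := measurableSet_ball
  have : IsFiniteMeasure (volume.restrict B) := ⟨by
    rw [Measure.restrict_apply_univ]; exact measure_ball_lt_top⟩
  have hu : IntegrableOn u B := h.memLp.integrable hp1
  have hDu : IntegrableOn Du B := h.memLp_grad.integrable hp1
  set U := B.indicator u with hUdef
  set G := B.indicator Du with hGdef
  have hU : Integrable U := (integrable_indicator_iff hBm).2 hu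
  have hG : Integrable G := (integrable_indicator_iff hBm).2 hDu
  have hGm : AEMeasurable (fun z => ‖G z‖ₑ) volume := hG.aestronglyMeasurable.enorm
  have hGe : (fun z => ‖G z‖ₑ) = B.indicator fun z => ‖Du z‖ₑ := by
    funext z
    by_cases hz : z ∈ B <;> simp [hGdef, hz]
  -- mollifiers with shrinking radii
  let φ : ℕ → ContDiffBump (0 : Rn n) := fun k =>
    ⟨1 / (2 * ((k : ℝ) + 1)), 1 / ((k : ℝ) + 1), by positivity, by
      gcongr; linarith [k.cast_nonneg (α := ℝ)]⟩
  have hφ0 : Filter.Tendsto (fun k => (φ k).rOut) Filter.atTop (nhds 0) :=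
    tendsto_one_div_add_atTop_nhds_zero_nat
  have hφK : ∀ k, (φ k).rOut ≤ 2 * (φ k).rIn := by
    intro k
    change 1 / ((k : ℝ) + 1) ≤ 2 * (1 / (2 * ((k : ℝ) + 1)))
    apply le_of_eq
    field_simp
  set v : ℕ → Rn n → ℝ := fun k =>
    (φ k).normed volume ⋆[ContinuousLinearMap.lsmul ℝ ℝ, volume] U with hv
  set g : ℕ → Rn n → Rn n := fun k =>
    (φ k).normed volume ⋆[ContinuousLinearMap.lsmul ℝ ℝ, volume] G with hg
  have hvs : ∀ k, ContDiff ℝ 1 (v k) := fun k =>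
    (φ k).hasCompactSupport_normed.contDiff_convolution_left (n := 1) _ (φ k).contDiff_normed
      hU.locallyIntegrable
  have hgc : ∀ k, Continuous (g k) := fun k =>
    (φ k).hasCompactSupport_normed.continuous_convolution_left _
      ((φ k).contDiff_normed (n := 1)).continuous hG.locallyIntegrable
  have hvlim := ContDiffBump.ae_convolution_tendsto_right_of_locallyIntegrable (μ := volume)
    hφ0 (Filter.Eventually.of_forall hφK) hU.locallyIntegrable
  have hglim := ContDiffBump.ae_convolution_tendsto_right_of_locallyIntegrable (μ := volume)
    hφ0 (Filter.Eventually.of_forall hφK) hG.locallyIntegrable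
  -- the potential of the maximal function, which dominates those of the mollified gradients,
  -- is finite almost everywhere
  set MG := maximalFunction volume (fun z => ‖G z‖ₑ) with hMG
  have hMGm : Measurable MG := measurable_maximalFunction _
  have hfinite : ∀ᵐ x : Rn n, rieszPotential volume 1 MG x < ⊤ := by
    have hr : 0 < 1 / p - 1 / (n : ℝ) := by
      rw [sub_pos]; exact one_div_lt_one_div_of_lt hp0 hpn
    set r := 1 / (1 / p - 1 / (n : ℝ)) with hrdef
    have hr0 : 0 < r := by positivity
    obtain ⟨C, hC⟩ := lintegral_rieszPotential_rpow_le (μ := (volume : Measure (Rn n)))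
      (β := 1) (r := r) hp one_pos hr0 (by rw [hrdef, one_div_one_div, hfin])
    obtain ⟨D, hD⟩ := lintegral_maximalFunction_rpow_le (μ := (volume : Measure (Rn n))) hp
    have h1 : ∫⁻ z, ‖G z‖ₑ ^ p < ⊤ := by
      have := h.memLp_grad.2
      rw [← eLpNorm_indicator_eq_eLpNorm_restrict hBm] at this
      have h2 := lintegral_rpow_enorm_lt_top_of_eLpNorm_lt_top (by simpa using hp0)
        ENNReal.ofReal_ne_top this
      rwa [ENNReal.toReal_ofReal hp0.le] at h2
    have h2 : ∫⁻ z, MG z ^ p < ⊤ :=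
      (hD _ hGm).trans_lt (ENNReal.mul_lt_top ENNReal.coe_lt_top h1)
    have h3 : ∫⁻ x, rieszPotential volume 1 MG x ^ r < ⊤ := by
      have h4 : (∫⁻ x, rieszPotential volume 1 MG x ^ r) ^ (1 / r) < ⊤ :=
        (hC MG hMGm.aemeasurable).trans_lt (ENNReal.mul_lt_top ENNReal.coe_lt_top
          (ENNReal.rpow_lt_top_of_nonneg (by positivity) h2.ne))
      rwa [ENNReal.rpow_lt_top_iff_of_pos (by positivity)] at h4
    filter_upwards [ae_lt_top ((measurable_rieszPotential 1 hMGm.aemeasurable).pow_const r) h3.ne]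
      with x hx
    rwa [ENNReal.rpow_lt_top_iff_of_pos hr0] at hx
  -- the estimate on smaller concentric balls
  have hsmall : ∀ᵐ x : Rn n, ∀ j : ℕ, x ∈ ball x₀ (R - 1 / ((j : ℝ) + 1)) →
      ∫⁻ y in ball x₀ (R - 1 / ((j : ℝ) + 1)), ‖U x - U y‖ₑ ≤
        ENNReal.ofReal ((2 * R) ^ (n : ℝ)) * rieszPotential volume 1 (fun z => ‖G z‖ₑ) x := by
    filter_upwards [hvlim, hfinite] with x hxv hxf j hxj
    set ρ := R - 1 / ((j : ℝ) + 1) with hρ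
    have hj : 0 < 1 / ((j : ℝ) + 1) := by positivity
    have hρ0 : 0 < ρ := by
      by_contra! hcon
      rw [ball_eq_empty.2 hcon] at hxj
      exact hxj
    have hbound : ∀ᶠ k in Filter.atTop, ∫⁻ y in ball x₀ ρ, ‖v k x - v k y‖ₑ ≤
        ENNReal.ofReal ((2 * R) ^ (n : ℝ)) *
          rieszPotential volume 1 ((ball x₀ ρ).indicator fun z => ‖g k z‖ₑ) x := by
      filter_upwards [hφ0.eventually (gt_mem_nhds hj)] with k hk
      have h1 := lintegral_enorm_sub_le_rieszPotential_of_contDiff (μ := volume) (hvs k) x₀ hρ0 hxj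
      rw [hfin] at h1
      refine h1.trans (mul_le_mul' (ENNReal.ofReal_le_ofReal ?_) (rieszPotential_mono ?_ x))
      · exact Real.rpow_le_rpow (by positivity) (by linarith) hn0.le
      · intro z
        by_cases hz : z ∈ ball x₀ ρ
        · rw [Set.indicator_of_mem hz, Set.indicator_of_mem hz, enorm_le_iff_norm_le]
          refine norm_le_norm_of_apply_single_eq fun i => ?_
          refine fderiv_normed_convolution_apply hBm h.hasWeakGradient hu hDu (φ k) ?_ i
          refine (closedBall_subset_closedBall' (y := x₀) le_rfl).trans
            (closedBall_subset_ball ?_)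
          rw [mem_ball] at hz
          linarith
        · rw [Set.indicator_of_notMem hz, Set.indicator_of_notMem hz]
    have hlim : Filter.Tendsto (fun k =>
        rieszPotential volume 1 ((ball x₀ ρ).indicator fun z => ‖g k z‖ₑ) x) Filter.atTop
        (nhds (rieszPotential volume 1 ((ball x₀ ρ).indicator fun z => ‖G z‖ₑ) x)) := by
      refine tendsto_lintegral_of_dominated_convergence
        (fun z => (ENNReal.ofReal (2 ^ finrank ℝ (Rn n)) * MG z) *
          ‖x - z‖ₑ ^ (1 - (finrank ℝ (Rn n) : ℝ))) (fun k => ?_) (fun k => ?_) ?_ ?_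
      · exact ((hgc k).enorm.measurable.indicator measurableSet_ball).mul (by fun_prop)
      · refine Filter.Eventually.of_forall fun z => ?_
        refine mul_le_mul_left ?_ _
        refine (Set.indicator_le_self _ _ z).trans ?_
        exact enorm_normed_convolution_le_maximalFunction (φ k) (hφK k) G z
      · simp_rw [mul_assoc]
        rw [lintegral_const_mul' _ _ ENNReal.ofReal_ne_top]
        exact (ENNReal.mul_lt_top ENNReal.ofReal_lt_top hxf).ne
      · filter_upwards [hglim, Measure.ae_ne volume x] with z hz hzx
        refine ENNReal.Tendsto.mul_const ?_ (Or.inr ?_)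
        · by_cases hzB : z ∈ ball x₀ ρ
          · simp only [Set.indicator_of_mem hzB]
            exact (continuous_enorm.tendsto _).comp hz
          · simp only [Set.indicator_of_notMem hzB]
            exact tendsto_const_nhds
        · have : ‖x - z‖ₑ ≠ 0 := by simpa [sub_eq_zero] using hzx.symm
          simp [ENNReal.rpow_eq_top_iff, this]
    calc ∫⁻ y in ball x₀ ρ, ‖U x - U y‖ₑ
        ≤ ∫⁻ y in ball x₀ ρ, Filter.liminf (fun k => ‖v k x - v k y‖ₑ) Filter.atTop := by
          refine lintegral_mono_ae (ae_restrict_of_ae ?_)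
          filter_upwards [hvlim] with y hy
          exact ((continuous_enorm.tendsto _).comp (hxv.sub hy)).liminf_eq.ge
      _ ≤ Filter.liminf (fun k => ∫⁻ y in ball x₀ ρ, ‖v k x - v k y‖ₑ) Filter.atTop :=
          lintegral_liminf_le fun k =>
            (continuous_const.sub (hvs k).continuous).enorm.measurable
      _ ≤ Filter.liminf (fun k => ENNReal.ofReal ((2 * R) ^ (n : ℝ)) *
          rieszPotential volume 1 ((ball x₀ ρ).indicator fun z => ‖g k z‖ₑ) x) Filter.atTop :=
          Filter.liminf_le_liminf hbound
      _ = ENNReal.ofReal ((2 * R) ^ (n : ℝ)) *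
          rieszPotential volume 1 ((ball x₀ ρ).indicator fun z => ‖G z‖ₑ) x :=
          (ENNReal.Tendsto.const_mul hlim (Or.inr ENNReal.ofReal_ne_top)).liminf_eq
      _ ≤ _ := mul_le_mul_right (rieszPotential_mono (Set.indicator_le_self _ _) x) _
  rw [← hGe, ae_restrict_iff' hBm]
  filter_upwards [hsmall] with x hx hxB
  rw [hB, lintegral_ball_eq_iSup]
  refine iSup_le fun k => ?_
  obtain ⟨m, hm⟩ := exists_nat_one_div_lt (sub_pos.2 (mem_ball.1 hxB))
  have hle : ∀ i j : ℕ, i ≤ j → R - 1 / ((i : ℝ) + 1) ≤ R - 1 / ((j : ℝ) + 1) := by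
    intro i j hij
    gcongr
  have hxm : x ∈ ball x₀ (R - 1 / (((max k m : ℕ) : ℝ) + 1)) := by
    rw [mem_ball]
    have := hle m (max k m) (le_max_right _ _)
    linarith
  refine le_trans ?_ (hx (max k m) hxm)
  calc _ = ∫⁻ y in ball x₀ (R - 1 / ((k : ℝ) + 1)), ‖U x - U y‖ₑ := by
        refine setLIntegral_congr_fun measurableSet_ball fun y hy => ?_
        have hyB : y ∈ B := ball_subset_ball (by
          have : 0 < 1 / ((k : ℝ) + 1) := by positivity
          linarith) hy
        simp only [hUdef, Set.indicator_of_mem hxB, Set.indicator_of_mem hyB]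
    _ ≤ _ := lintegral_mono_set (ball_subset_ball (hle _ _ (le_max_left _ _)))

end WeakGradient

/-! ### The weighted Sobolev–Poincaré inequality -/

section Weights

theorem zSeminorm_nonneg {n : ℕ} {α : ℝ} {Ω : Set (Rn n)} {a : Rn n → ℝ} :
    0 ≤ zSeminorm α Ω a :=
  Real.sInf_nonneg fun _ hC => hC.1.le

/-- The infimum of the admissible constants satisfies the defining inequality as well. -/
theorem MemZ.le_zSeminorm_mul {n : ℕ} {α : ℝ} {Ω : Set (Rn n)} {a : Rn n → ℝ} (h : MemZ α Ω a)
    {x y : Rn n} (hx : x ∈ Ω) (hy : y ∈ Ω) :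
    a x ≤ zSeminorm α Ω a * (a y + ‖x - y‖ ^ α) := by
  have h0 : 0 ≤ a y + ‖x - y‖ ^ α :=
    add_nonneg (h.nonneg y hy) (Real.rpow_nonneg (norm_nonneg _) _)
  rcases h0.eq_or_lt with h0 | h0
  · obtain ⟨C, hC⟩ := h.exists_const
    have := hC.2 x hx y hy
    rwa [← h0, mul_zero] at this ⊢
  · rw [← div_le_iff₀ h0]
    refine le_csInf h.exists_const fun C hC => ?_
    rw [div_le_iff₀ h0]
    exact hC.2 x hx y hy

theorem MemZ.ofReal_rpow_le {n : ℕ} {α q : ℝ} {Ω : Set (Rn n)} {a : Rn n → ℝ} (h : MemZ α Ω a)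
    (hq : 1 ≤ q) {x y : Rn n} (hx : x ∈ Ω) (hy : y ∈ Ω) (hxy : x ≠ y) :
    ENNReal.ofReal (a x) ^ (1 / q) ≤ ENNReal.ofReal (zSeminorm α Ω a) ^ (1 / q) *
      (ENNReal.ofReal (a y) ^ (1 / q) + ‖x - y‖ₑ ^ (α / q)) := by
  have hq0 : 0 < 1 / q := by positivity
  have hxy' : 0 < ‖x - y‖ := norm_pos_iff.2 (sub_ne_zero.2 hxy)
  calc ENNReal.ofReal (a x) ^ (1 / q)
      ≤ ENNReal.ofReal (zSeminorm α Ω a * (a y + ‖x - y‖ ^ α)) ^ (1 / q) :=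
        ENNReal.rpow_le_rpow (ENNReal.ofReal_le_ofReal (h.le_zSeminorm_mul hx hy)) hq0.le
    _ = ENNReal.ofReal (zSeminorm α Ω a) ^ (1 / q) *
          (ENNReal.ofReal (a y) + ‖x - y‖ₑ ^ α) ^ (1 / q) := by
        rw [ENNReal.ofReal_mul zSeminorm_nonneg, ENNReal.mul_rpow_of_nonneg _ _ hq0.le,
          ENNReal.ofReal_add (h.nonneg y hy) (by positivity), ← ENNReal.ofReal_rpow_of_pos hxy',
          ofReal_norm]
    _ ≤ _ := by
        gcongr
        refine (ENNReal.rpow_add_le_add_rpow _ _ hq0.le ?_).trans_eq ?_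
        · rw [div_le_one (by linarith)]; exact hq
        · rw [← ENNReal.rpow_mul, mul_one_div]

/-- If the weighted mean of `u` vanishes, then `u x` is the weighted mean of `u x - u`, hence it is
controlled by the mean oscillation around `u x`. -/
theorem enorm_mul_volume_le_of_weightedMean_eq_zero {n : ℕ} {x₀ : Rn n} {R : ℝ} (hR : 0 < R)
    {η u : Rn n → ℝ} (hηm : AEMeasurable η (volume.restrict (ball x₀ R)))
    (hη : ∀ᵐ x ∂(volume.restrict (ball x₀ R)), 0 ≤ η x ∧ η x ≤ 1)
    (hη1 : volume.real (ball x₀ (R / 2)) ≤ ∫ x in ball x₀ R, |η x|)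
    (hu : IntegrableOn u (ball x₀ R)) (h0 : weightedMean (ball x₀ R) η u = 0) (x : Rn n) :
    ‖u x‖ₑ * volume (ball x₀ (R / 2)) ≤ ∫⁻ y in ball x₀ R, ‖u x - u y‖ₑ := by
  set ν := volume.restrict (ball x₀ R)
  have : IsFiniteMeasure ν := ⟨by
    rw [Measure.restrict_apply_univ]; exact measure_ball_lt_top⟩
  have hVt : volume (ball x₀ (R / 2)) ≠ ⊤ := measure_ball_lt_top.ne
  have hV : 0 < volume.real (ball x₀ (R / 2)) :=
    ENNReal.toReal_pos (measure_ball_pos _ _ (by positivity)).ne' hVt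
  have hη' : ∀ᵐ y ∂ν, ‖η y‖ ≤ 1 := by
    filter_upwards [hη] with y hy
    rw [Real.norm_of_nonneg hy.1]; exact hy.2
  have hηi : Integrable η ν := Integrable.of_bound hηm.aestronglyMeasurable 1 hη'
  have huη : Integrable (fun y => u y * η y) ν := Integrable.mul_bdd hu hηm.aestronglyMeasurable hη'
  have habs : ∫ y, |η y| ∂ν = ∫ y, η y ∂ν := by
    refine integral_congr_ae ?_
    filter_upwards [hη] with y hy
    exact abs_of_nonneg hy.1
  have hz : ∫ y, u y * η y ∂ν = 0 := by
    rw [weightedMean, mul_eq_zero] at h0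
    refine h0.resolve_left ?_
    have : 0 < ∫ y, |η y| ∂ν := hV.trans_le hη1
    positivity
  have hkey : u x * ∫ y, |η y| ∂ν = ∫ y, (u x - u y) * η y ∂ν := by
    simp_rw [sub_mul]
    rw [integral_sub (hηi.const_mul _) huη, hz, sub_zero, integral_const_mul, habs]
  calc ‖u x‖ₑ * volume (ball x₀ (R / 2))
      ≤ ‖u x‖ₑ * ENNReal.ofReal (∫ y, |η y| ∂ν) := by
        gcongr
        rw [← ENNReal.ofReal_toReal hVt]
        exact ENNReal.ofReal_le_ofReal hη1
    _ = ‖∫ y, (u x - u y) * η y ∂ν‖ₑ := by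
        rw [← hkey, enorm_mul, Real.enorm_of_nonneg (hV.le.trans hη1)]
    _ ≤ ∫⁻ y, ‖(u x - u y) * η y‖ₑ ∂ν := enorm_integral_le_lintegral_enorm _
    _ ≤ ∫⁻ y, ‖u x - u y‖ₑ ∂ν := by
        refine lintegral_mono_ae ?_
        filter_upwards [hη'] with y hy
        rw [enorm_mul]
        refine mul_le_of_le_one_right' ?_
        rw [← ofReal_norm]
        exact ENNReal.ofReal_le_one.2 hy

/-- Moving the weight inside the potential of order one. The weight at `x` is bounded by the weight
at `z` plus a power of `|x - z|`, and this power raises the order of the potential. -/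
theorem MemZ.ofReal_rpow_mul_rieszPotential_le {n : ℕ} [NeZero n] {α q β : ℝ} {x₀ : Rn n} {R : ℝ}
    {a : Rn n → ℝ} (h : MemZ α (ball x₀ R) a) (hq : 1 ≤ q) (hβ : β ≤ 1 + α / q)
    {g : Rn n → ℝ≥0∞} (hg : AEMeasurable g (volume.restrict (ball x₀ R))) {x : Rn n}
    (hx : x ∈ ball x₀ R) :
    ENNReal.ofReal (a x) ^ (1 / q) * rieszPotential volume 1 ((ball x₀ R).indicator g) x ≤
      ENNReal.ofReal (zSeminorm α (ball x₀ R) a) ^ (1 / q) *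
        (rieszPotential volume 1
            ((ball x₀ R).indicator fun z => ENNReal.ofReal (a z) ^ (1 / q) * g z) x +
          ENNReal.ofReal ((2 * R) ^ (1 + α / q - β)) *
            rieszPotential volume β ((ball x₀ R).indicator g) x) := by
  have hq0 : 0 < 1 / q := by positivity
  have hfin : finrank ℝ (Rn n) = n := by simp
  have hR : 0 < R := by
    by_contra! hcon
    rw [ball_eq_empty.2 hcon] at hx
    exact hx
  have hfm : AEMeasurable ((ball x₀ R).indicator fun z => ENNReal.ofReal (a z) ^ (1 / q) * g z) :=
    (aemeasurable_indicator_iff measurableSet_ball).2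
      ((h.aemeasurable.ennreal_ofReal.pow_const _).mul hg)
  have hw : ENNReal.ofReal (a x) ^ (1 / q) ≠ ⊤ :=
    ENNReal.rpow_ne_top_of_nonneg hq0.le ENNReal.ofReal_ne_top
  have hK : ENNReal.ofReal (zSeminorm α (ball x₀ R) a) ^ (1 / q) ≠ ⊤ :=
    ENNReal.rpow_ne_top_of_nonneg hq0.le ENNReal.ofReal_ne_top
  simp only [rieszPotential]
  rw [hfin, ← lintegral_const_mul' _ _ hw, ← lintegral_const_mul' _ _ ENNReal.ofReal_ne_top,
    ← lintegral_add_left' (hfm.fun_mul (by fun_prop)), ← lintegral_const_mul' _ _ hK]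
  refine lintegral_mono_ae ?_
  filter_upwards [Measure.ae_ne volume x] with z hz
  by_cases hzB : z ∈ ball x₀ R
  swap
  · simp [hzB]
  simp only [Set.indicator_of_mem hzB]
  have hxz : 0 < ‖x - z‖ := norm_pos_iff.2 (sub_ne_zero.2 hz.symm)
  have hxz' : ‖x - z‖ ≤ 2 * R := by
    rw [← dist_eq_norm]
    have := dist_triangle_right x z x₀
    rw [mem_ball] at hx hzB
    linarith
  -- lowering the order of the kernel to `β` costs a power of the diameter
  have hker : ‖x - z‖ₑ ^ (α / q) * ‖x - z‖ₑ ^ (1 - (n : ℝ)) ≤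
      ENNReal.ofReal ((2 * R) ^ (1 + α / q - β)) * ‖x - z‖ₑ ^ (β - (n : ℝ)) := by
    simp only [← ofReal_norm, ENNReal.ofReal_rpow_of_pos hxz]
    rw [← ENNReal.ofReal_mul (by positivity), ← ENNReal.ofReal_mul (by positivity),
      ← Real.rpow_add hxz, show α / q + (1 - (n : ℝ)) = (1 + α / q - β) + (β - n) by ring,
      Real.rpow_add hxz]
    refine ENNReal.ofReal_le_ofReal ?_
    gcongr
  calc ENNReal.ofReal (a x) ^ (1 / q) * (g z * ‖x - z‖ₑ ^ (1 - (n : ℝ)))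
      ≤ ENNReal.ofReal (zSeminorm α (ball x₀ R) a) ^ (1 / q) *
          (ENNReal.ofReal (a z) ^ (1 / q) + ‖x - z‖ₑ ^ (α / q)) *
          (g z * ‖x - z‖ₑ ^ (1 - (n : ℝ))) := by
        gcongr
        exact h.ofReal_rpow_le hq hx hzB hz.symm
    _ = ENNReal.ofReal (zSeminorm α (ball x₀ R) a) ^ (1 / q) *
          (ENNReal.ofReal (a z) ^ (1 / q) * g z * ‖x - z‖ₑ ^ (1 - (n : ℝ)) +
            g z * (‖x - z‖ₑ ^ (α / q) * ‖x - z‖ₑ ^ (1 - (n : ℝ)))) := by ring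
    _ ≤ ENNReal.ofReal (zSeminorm α (ball x₀ R) a) ^ (1 / q) *
          (ENNReal.ofReal (a z) ^ (1 / q) * g z * ‖x - z‖ₑ ^ (1 - (n : ℝ)) +
            g z * (ENNReal.ofReal ((2 * R) ^ (1 + α / q - β)) * ‖x - z‖ₑ ^ (β - (n : ℝ)))) := by
        gcongr
    _ = _ := by ring

/-- The weighted Sobolev–Poincaré inequality in `[0, ∞]`, without normalisation of the integrals. -/
theorem lintegral_weighted_sobolev_le {n : ℕ} {p q α : ℝ} (hp : 1 < p) (hpq : p ≤ q) (hqn : q < n)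
    (hqp : q / p ≤ 1 + α / n) :
    ∃ C : ℝ≥0, ∀ (x₀ : Rn n) (R : ℝ), 0 < R →
      ∀ a : Rn n → ℝ, MemZ α (ball x₀ R) a →
      ∀ η : Rn n → ℝ, AEMeasurable η (volume.restrict (ball x₀ R)) →
        (∀ᵐ x ∂(volume.restrict (ball x₀ R)), 0 ≤ η x ∧ η x ≤ 1) →
        volume.real (ball x₀ (R / 2)) ≤ ∫ x in ball x₀ R, |η x| →
      ∀ (u : Rn n → ℝ) (Du : Rn n → Rn n), MemW1p p (ball x₀ R) u Du →
        weightedMean (ball x₀ R) η u = 0 →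
      (∫⁻ x in ball x₀ R, (ENNReal.ofReal (a x) ^ (1 / q) * ‖u x‖ₑ) ^ sobolevExponent n q) ^
          (1 / sobolevExponent n q) ≤
        C * ENNReal.ofReal (zSeminorm α (ball x₀ R) a) ^ (1 / q) *
          ((∫⁻ x in ball x₀ R, ENNReal.ofReal (a x) * ‖Du x‖ₑ ^ q) ^ (1 / q) +
            ENNReal.ofReal (R ^ (α / q - n / p + n / q)) *
              (∫⁻ x in ball x₀ R, ‖Du x‖ₑ ^ p) ^ (1 / p)) := by
  have hp0 : 0 < p := by linarith
  have hq1 : 1 < q := by linarith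
  have hq0 : 0 < q := by linarith
  have hn0 : (0 : ℝ) < n := by linarith
  have hnq : 0 < n - q := by linarith
  have hnz : NeZero n := ⟨by rintro rfl; simp at hn0⟩
  have hfin : finrank ℝ (Rn n) = n := by simp
  set r := sobolevExponent n q with hr
  have hr0 : 0 < r := by rw [hr, sobolevExponent]; positivity
  have hr1 : 1 ≤ r := by
    rw [hr, sobolevExponent, one_le_div hnq]
    nlinarith
  have hrinv : 1 / r = 1 / q - 1 / n := by
    rw [hr, sobolevExponent]; field_simp
  -- the order for which the Riesz potential maps `L^p` to `L^r`
  set β : ℝ := 1 + n / p - n / q with hβ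
  have hβ0 : 0 < β := by
    have : (n : ℝ) / q ≤ n / p := by gcongr
    linarith
  have hβ1 : β ≤ 1 + α / q := by
    have h1 : n / q * (q / p) ≤ n / q * (1 + α / n) := by gcongr
    have h2 : n / q * (q / p) = n / p := by field_simp
    have h3 : n / q * (1 + α / n) = n / q + α / q := by field_simp
    linarith
  obtain ⟨C₁, hC₁⟩ := lintegral_rieszPotential_rpow_le (μ := (volume : Measure (Rn n)))
    hq1 one_pos hr0 (by rw [hfin, hrinv])
  obtain ⟨C₂, hC₂⟩ := lintegral_rieszPotential_rpow_le (μ := (volume : Measure (Rn n)))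
    (r := r) hp hβ0 hr0 (by rw [hfin, hrinv, hβ]; field_simp; ring)
  have hV0 : volume (ball (0 : Rn n) 1) ≠ 0 := (measure_ball_pos _ _ one_pos).ne'
  have hVt : volume (ball (0 : Rn n) 1) ≠ ⊤ := measure_ball_lt_top.ne
  obtain ⟨V, hV⟩ : ∃ V : ℝ≥0, volume (ball (0 : Rn n) 1) = V :=
    ⟨_, (ENNReal.coe_toNNReal hVt).symm⟩
  have hV0' : V ≠ 0 := by rintro rfl; exact hV0 (by simpa using hV)
  set C₀ : ℝ≥0 := 4 ^ (n : ℝ) / V with hC₀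
  refine ⟨C₀ * (C₁ + Real.toNNReal (2 ^ (1 + α / q - β)) * C₂), ?_⟩
  intro x₀ R hR a ha η hηm hη hη1 u Du hu h0
  set B := ball x₀ R with hB
  have hBm : MeasurableSet B := measurableSet_ball
  have : IsFiniteMeasure (volume.restrict B) := ⟨by
    rw [Measure.restrict_apply_univ]; exact measure_ball_lt_top⟩
  have huI : IntegrableOn u B := hu.memLp.integrable (by
    rw [← ENNReal.ofReal_one]; exact ENNReal.ofReal_le_ofReal hp.le)
  have hDum : AEMeasurable (fun z => ‖Du z‖ₑ) (volume.restrict B) :=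
    hu.memLp_grad.aestronglyMeasurable.enorm
  set g : Rn n → ℝ≥0∞ := B.indicator fun z => ‖Du z‖ₑ with hg
  set f : Rn n → ℝ≥0∞ := B.indicator fun z => ENNReal.ofReal (a z) ^ (1 / q) * ‖Du z‖ₑ with hf
  have hgm : AEMeasurable g := (aemeasurable_indicator_iff hBm).2 hDum
  have hfm : AEMeasurable f := (aemeasurable_indicator_iff hBm).2
    ((ha.aemeasurable.ennreal_ofReal.pow_const _).mul hDum)
  have hgint : ∫⁻ z, g z ^ p = ∫⁻ x in B, ‖Du x‖ₑ ^ p := by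
    rw [← lintegral_indicator hBm]
    refine lintegral_congr fun z => ?_
    by_cases hz : z ∈ B <;> simp [hg, hz, hp0]
  have hfint : ∫⁻ z, f z ^ q = ∫⁻ x in B, ENNReal.ofReal (a x) * ‖Du x‖ₑ ^ q := by
    rw [← lintegral_indicator hBm]
    refine lintegral_congr fun z => ?_
    by_cases hz : z ∈ B
    · simp only [hf, Set.indicator_of_mem hz]
      rw [ENNReal.mul_rpow_of_nonneg _ _ hq0.le, ← ENNReal.rpow_mul, one_div_mul_cancel hq0.ne',
        ENNReal.rpow_one]
    · simp [hf, hz, hq0]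
  set K := ENNReal.ofReal (zSeminorm α B a) ^ (1 / q)
  set D := ENNReal.ofReal ((2 * R) ^ (1 + α / q - β)) with hD
  -- the pointwise estimate by Riesz potentials
  have hpt : ∀ᵐ x ∂(volume.restrict B), ENNReal.ofReal (a x) ^ (1 / q) * ‖u x‖ₑ ≤
      C₀ * K * (rieszPotential volume 1 f x + D * rieszPotential volume β g x) := by
    filter_upwards [ae_lintegral_enorm_sub_le_rieszPotential hp (hpq.trans_lt hqn) hu,
      self_mem_ae_restrict hBm] with x hx hxB
    have hVR : ENNReal.ofReal ((2 * R) ^ (n : ℝ)) = C₀ * volume (ball x₀ (R / 2)) := by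
      have e : (C₀ : ℝ≥0∞) * V = ENNReal.ofReal (4 ^ (n : ℝ)) := by
        rw [← ENNReal.coe_mul, hC₀, div_mul_cancel₀ _ hV0', ← ENNReal.ofReal_coe_nnreal]
        simp
      rw [Measure.addHaar_ball_of_pos _ _ (by positivity), hV, hfin, mul_left_comm, e,
        ← Real.rpow_natCast, ← ENNReal.ofReal_mul (by positivity),
        ← Real.mul_rpow (by positivity) (by positivity)]
      congr 2
      ring
    have hux : ‖u x‖ₑ ≤ C₀ * rieszPotential volume 1 g x := by
      have h1 := (enorm_mul_volume_le_of_weightedMean_eq_zero hR hηm hη hη1 huI h0 x).trans hx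
      rw [hVR, mul_right_comm] at h1
      exact (ENNReal.mul_le_mul_iff_left (measure_ball_pos _ _ (by positivity)).ne'
        measure_ball_lt_top.ne).1 h1
    calc ENNReal.ofReal (a x) ^ (1 / q) * ‖u x‖ₑ
        ≤ ENNReal.ofReal (a x) ^ (1 / q) * (C₀ * rieszPotential volume 1 g x) := by gcongr
      _ = C₀ * (ENNReal.ofReal (a x) ^ (1 / q) * rieszPotential volume 1 g x) := mul_left_comm _ _ _
      _ ≤ C₀ * (K * (rieszPotential volume 1 f x + D * rieszPotential volume β g x)) := by
          exact mul_le_mul_right (ha.ofReal_rpow_mul_rieszPotential_le hq1.le hβ1 hDum hxB) _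
      _ = _ := (mul_assoc _ _ _).symm
  have hI1 : Measurable (rieszPotential volume 1 f) := measurable_rieszPotential 1 hfm
  have hI2 : Measurable (rieszPotential volume β g) := measurable_rieszPotential β hgm
  have hKt : (C₀ * K) ^ r ≠ ⊤ := ENNReal.rpow_ne_top_of_nonneg hr0.le
    (ENNReal.mul_ne_top ENNReal.coe_ne_top
      (ENNReal.rpow_ne_top_of_nonneg (by positivity) ENNReal.ofReal_ne_top))
  have hr0' : 0 ≤ 1 / r := by positivity
  calc (∫⁻ x in B, (ENNReal.ofReal (a x) ^ (1 / q) * ‖u x‖ₑ) ^ r) ^ (1 / r)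
      ≤ (∫⁻ x, (C₀ * K) ^ r *
          (rieszPotential volume 1 f x + D * rieszPotential volume β g x) ^ r) ^ (1 / r) := by
        refine ENNReal.rpow_le_rpow ((lintegral_mono_ae ?_).trans
          (setLIntegral_le_lintegral B _)) hr0'
        filter_upwards [hpt] with x hx
        rw [← ENNReal.mul_rpow_of_nonneg _ _ hr0.le]
        exact ENNReal.rpow_le_rpow hx hr0.le
    _ = C₀ * K * (∫⁻ x,
          (rieszPotential volume 1 f x + D * rieszPotential volume β g x) ^ r) ^ (1 / r) := by
        rw [lintegral_const_mul' _ _ hKt, ENNReal.mul_rpow_of_nonneg _ _ hr0', ← ENNReal.rpow_mul,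
          mul_one_div_cancel hr0.ne', ENNReal.rpow_one]
    _ ≤ C₀ * K * ((∫⁻ x, rieszPotential volume 1 f x ^ r) ^ (1 / r) +
          (∫⁻ x, (D * rieszPotential volume β g x) ^ r) ^ (1 / r)) := by
        gcongr
        exact ENNReal.lintegral_Lp_add_le hI1.aemeasurable (hI2.const_mul D).aemeasurable hr1
    _ = C₀ * K * ((∫⁻ x, rieszPotential volume 1 f x ^ r) ^ (1 / r) +
          D * (∫⁻ x, rieszPotential volume β g x ^ r) ^ (1 / r)) := by
        simp_rw [ENNReal.mul_rpow_of_nonneg _ _ hr0.le]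
        rw [lintegral_const_mul' _ _ (ENNReal.rpow_ne_top_of_nonneg hr0.le ENNReal.ofReal_ne_top),
          ENNReal.mul_rpow_of_nonneg _ _ hr0', ← ENNReal.rpow_mul, mul_one_div_cancel hr0.ne',
          ENNReal.rpow_one]
    _ ≤ C₀ * K * (C₁ * (∫⁻ z, f z ^ q) ^ (1 / q) + D * (C₂ * (∫⁻ z, g z ^ p) ^ (1 / p))) := by
        gcongr
        · exact hC₁ f hfm
        · exact hC₂ g hgm
    _ ≤ _ := by
        rw [hfint, hgint, hD, Real.mul_rpow (by norm_num) hR.le, ENNReal.ofReal_mul (by positivity),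
          show 1 + α / q - β = α / q - n / p + n / q by rw [hβ]; ring]
        generalize (∫⁻ x in B, ENNReal.ofReal (a x) * ‖Du x‖ₑ ^ q) ^ (1 / q) = S
        generalize (∫⁻ x in B, ‖Du x‖ₑ ^ p) ^ (1 / p) = T
        generalize ENNReal.ofReal (R ^ (α / q - n / p + n / q)) = ρ
        rw [ENNReal.coe_mul, ENNReal.coe_add, ENNReal.coe_mul, ← ENNReal.ofReal]
        generalize ENNReal.ofReal (2 ^ (α / q - n / p + n / q)) = τ
        calc C₀ * K * (C₁ * S + τ * ρ * (C₂ * T))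
            = C₀ * K * (C₁ * S + τ * C₂ * (ρ * T)) := by ring
          _ ≤ C₀ * K * ((C₁ + τ * C₂) * S + (C₁ + τ * C₂) * (ρ * T)) := by
              gcongr
              · exact le_self_add
              · exact le_add_self
          _ = _ := by ring

end Weights

end DoublePhase

theorem theorem3p5 (n : ℕ) (p q α : ℝ) (hp : 1 < p) (hpq : p ≤ q) (hqn : q < n)
    (hα : 0 < α) (hqp : q / p ≤ 1 + α / n) :
    ∃ c : ℝ → ℝ, (∀ K : ℝ, 0 < c K) ∧
      ∀ (x₀ : DoublePhase.Rn n) (R : ℝ), 0 < R →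
      ∀ a : DoublePhase.Rn n → ℝ, DoublePhase.MemZ α (ball x₀ R) a →
      ∀ η : DoublePhase.Rn n → ℝ,
        AEMeasurable η (volume.restrict (ball x₀ R)) →
        (∀ᵐ x ∂(volume.restrict (ball x₀ R)), 0 ≤ η x ∧ η x ≤ 1) →
        volume.real (ball x₀ (R / 2)) ≤ ∫ x in ball x₀ R, |η x| →
      ∀ (u : DoublePhase.Rn n → ℝ) (Du : DoublePhase.Rn n → DoublePhase.Rn n),
        DoublePhase.MemW1p p (ball x₀ R) u Du →
        IntegrableOn (fun x => a x * ‖Du x‖ ^ q) (ball x₀ R) →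
        DoublePhase.weightedMean (ball x₀ R) η u = 0 →
        IntegrableOn (fun x => a x ^ (DoublePhase.sobolevExponent n q / q)
            * |u x / R| ^ DoublePhase.sobolevExponent n q) (ball x₀ R) ∧
        (⨍ x in ball x₀ R, a x ^ (DoublePhase.sobolevExponent n q / q)
            * |u x / R| ^ DoublePhase.sobolevExponent n q)
              ^ (1 / DoublePhase.sobolevExponent n q)
          ≤ c (DoublePhase.zSeminorm α (ball x₀ R) a)
              * (⨍ x in ball x₀ R, a x * ‖Du x‖ ^ q) ^ (1 / q)
            + c (DoublePhase.zSeminorm α (ball x₀ R) a)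
              * R ^ (α / q) * (⨍ x in ball x₀ R, ‖Du x‖ ^ p) ^ (1 / p) := by
  have hp0 : 0 < p := by linarith
  have hq0 : 0 < q := by linarith
  have hn0 : (0 : ℝ) < n := by linarith
  obtain ⟨C, hC⟩ := DoublePhase.lintegral_weighted_sobolev_le (α := α) hp hpq hqn hqp
  have hrinv : 1 / DoublePhase.sobolevExponent n q = 1 / q - 1 / n := by
    rw [DoublePhase.sobolevExponent]; field_simp
  have hr0 : 0 < DoublePhase.sobolevExponent n q := by
    rw [DoublePhase.sobolevExponent]; positivity
  generalize DoublePhase.sobolevExponent n q = r at hC hrinv hr0 ⊢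
  -- the volume of the unit ball enters through the normalisation of the integrals
  set V : ℝ := volume.real (ball (0 : DoublePhase.Rn n) 1) with hVdef
  have hV : 0 < V :=
    ENNReal.toReal_pos (measure_ball_pos _ _ one_pos).ne' measure_ball_lt_top.ne
  set A : ℝ := V ^ (-(1 / r)) * C * (V ^ (1 / q) + V ^ (1 / p)) with hA
  refine ⟨fun K => A * |K| ^ (1 / q) + 1, fun K => by positivity, ?_⟩
  intro x₀ R hR a ha η hηm hη hη1 u Du hu haDu h0
  have hmain := hC x₀ R hR a ha η hηm hη hη1 u Du hu h0
  set B := ball x₀ R with hB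
  have hBm : MeasurableSet B := measurableSet_ball
  set K := DoublePhase.zSeminorm α B a with hK
  have hK0 : 0 ≤ K := DoublePhase.zSeminorm_nonneg
  have hvol : volume.real B = V * R ^ n := by
    rw [Measure.real, hB, Measure.addHaar_ball_of_pos _ _ hR, ENNReal.toReal_mul,
      ENNReal.toReal_ofReal (by positivity), mul_comm, hVdef, Measure.real]
    simp
  -- the integrals on the right as real numbers
  set S := ∫ x in B, a x * ‖Du x‖ ^ q with hS
  set T := ∫ x in B, ‖Du x‖ ^ p with hT
  have hS0 : 0 ≤ S := setIntegral_nonneg hBm fun x hx =>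
    mul_nonneg (ha.nonneg x hx) (by positivity)
  have hT0 : 0 ≤ T := integral_nonneg fun x => by positivity
  have hSe : ∫⁻ x in B, ENNReal.ofReal (a x) * ‖Du x‖ₑ ^ q = ENNReal.ofReal S := by
    rw [hS, ofReal_integral_eq_lintegral_ofReal haDu]
    · refine setLIntegral_congr_fun hBm fun x hx => ?_
      rw [ENNReal.ofReal_mul (ha.nonneg x hx), ← ofReal_norm,
        ENNReal.ofReal_rpow_of_nonneg (norm_nonneg _) hq0.le]
    · filter_upwards [self_mem_ae_restrict hBm] with x hx
      exact mul_nonneg (ha.nonneg x hx) (by positivity)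
  have hTe : ∫⁻ x in B, ‖Du x‖ₑ ^ p = ENNReal.ofReal T := by
    rw [hT, ofReal_integral_eq_lintegral_ofReal]
    · refine lintegral_congr fun x => ?_
      rw [← ofReal_norm, ENNReal.ofReal_rpow_of_nonneg (norm_nonneg _) hp0.le]
    · have := hu.memLp_grad.integrable_norm_rpow (by simpa using hp0) ENNReal.ofReal_ne_top
      rwa [ENNReal.toReal_ofReal hp0.le] at this
    · exact Filter.Eventually.of_forall fun x => by positivity
  set ρ := R ^ (α / q - n / p + n / q) with hρ
  set Z := C * K ^ (1 / q) * (S ^ (1 / q) + ρ * T ^ (1 / p)) with hZ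
  have hZ0 : 0 ≤ Z := by positivity
  rw [hSe, hTe, ENNReal.ofReal_rpow_of_nonneg hS0 (by positivity),
    ENNReal.ofReal_rpow_of_nonneg hT0 (by positivity),
    ENNReal.ofReal_rpow_of_nonneg hK0 (by positivity), ← ENNReal.ofReal_mul (by positivity),
    ← ENNReal.ofReal_add (by positivity) (by positivity), ← ENNReal.ofReal_coe_nnreal,
    ← ENNReal.ofReal_mul (by positivity), ← ENNReal.ofReal_mul (by positivity), ← hZ] at hmain
  set F : DoublePhase.Rn n → ℝ := fun x => a x ^ (r / q) * |u x / R| ^ r with hF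
  have hF0 : ∀ x ∈ B, 0 ≤ F x := fun x hx =>
    mul_nonneg (Real.rpow_nonneg (ha.nonneg x hx) _) (by positivity)
  have hFe : ∫⁻ x in B, ENNReal.ofReal (F x) = ENNReal.ofReal (R ^ (-r)) *
      ∫⁻ x in B, (ENNReal.ofReal (a x) ^ (1 / q) * ‖u x‖ₑ) ^ r := by
    rw [← lintegral_const_mul' _ _ ENNReal.ofReal_ne_top]
    refine setLIntegral_congr_fun hBm fun x hx => ?_
    have hax := ha.nonneg x hx
    rw [ENNReal.ofReal_rpow_of_nonneg hax (by positivity), ← ofReal_norm,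
      ← ENNReal.ofReal_mul (by positivity), ENNReal.ofReal_rpow_of_nonneg (by positivity) hr0.le,
      ← ENNReal.ofReal_mul (by positivity)]
    congr 1
    simp only [hF]
    rw [Real.mul_rpow (by positivity) (by positivity), ← Real.rpow_mul hax, abs_div,
      abs_of_pos hR, Real.div_rpow (by positivity) hR.le, Real.rpow_neg hR.le, Real.norm_eq_abs,
      show 1 / q * r = r / q by ring]
    ring
  have hFle : ∫⁻ x in B, ENNReal.ofReal (F x) ≤ ENNReal.ofReal (R ^ (-r) * Z ^ r) := by
    rw [hFe, ENNReal.ofReal_mul (by positivity), ← ENNReal.ofReal_rpow_of_nonneg hZ0 hr0.le]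
    gcongr
    have := ENNReal.rpow_le_rpow hmain hr0.le
    rwa [← ENNReal.rpow_mul, one_div_mul_cancel hr0.ne', ENNReal.rpow_one] at this
  have hFm : AEStronglyMeasurable F (volume.restrict B) :=
    ((ha.aemeasurable.pow_const _).mul
      ((hu.memLp.aestronglyMeasurable.aemeasurable.div_const R).norm.pow_const r)).aestronglyMeasurable
  have hFae : 0 ≤ᵐ[volume.restrict B] F := by
    filter_upwards [self_mem_ae_restrict hBm] with x hx
    exact hF0 x hx
  have hFi : IntegrableOn F B :=
    (lintegral_ofReal_ne_top_iff_integrable hFm hFae).1 (hFle.trans_lt ENNReal.ofReal_lt_top).ne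
  refine ⟨hFi, ?_⟩
  have hJ : ∫ x in B, F x ≤ R ^ (-r) * Z ^ r := by
    rw [← ENNReal.ofReal_le_ofReal_iff (by positivity),
      ofReal_integral_eq_lintegral_ofReal hFi hFae]
    exact hFle
  have hJ0 : 0 ≤ ∫ x in B, F x := setIntegral_nonneg hBm hF0
  have hVR : 0 < V * R ^ n := by positivity
  have hpow : ∀ s : ℝ, (V * R ^ n) ^ s = V ^ s * R ^ (n * s) := by
    intro s
    rw [Real.mul_rpow hV.le (by positivity), ← Real.rpow_natCast, ← Real.rpow_mul hR.le]
  rw [setAverage_eq, setAverage_eq, setAverage_eq, hvol, smul_eq_mul, smul_eq_mul, smul_eq_mul]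
  change ((V * R ^ n)⁻¹ * ∫ x in B, F x) ^ (1 / r) ≤
    (A * |K| ^ (1 / q) + 1) * ((V * R ^ n)⁻¹ * S) ^ (1 / q) +
      (A * |K| ^ (1 / q) + 1) * R ^ (α / q) * ((V * R ^ n)⁻¹ * T) ^ (1 / p)
  rw [abs_of_nonneg hK0, Real.mul_rpow (by positivity) hS0, Real.mul_rpow (by positivity) hT0,
    Real.inv_rpow hVR.le, Real.inv_rpow hVR.le, ← Real.rpow_neg hVR.le, ← Real.rpow_neg hVR.le,
    hpow, hpow]
  have hL : ((V * R ^ n)⁻¹ * ∫ x in B, F x) ^ (1 / r) ≤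
      V ^ (-(1 / r)) * (R ^ (-(n / q : ℝ)) * Z) := by
    calc ((V * R ^ n)⁻¹ * ∫ x in B, F x) ^ (1 / r)
        ≤ ((V * R ^ n)⁻¹ * (R ^ (-r) * Z ^ r)) ^ (1 / r) := by gcongr
      _ = _ := by
        rw [Real.mul_rpow (by positivity) (by positivity),
          Real.mul_rpow (by positivity) (by positivity), ← Real.rpow_mul hZ0,
          mul_one_div_cancel hr0.ne', Real.rpow_one, Real.inv_rpow hVR.le, ← Real.rpow_neg hVR.le,
          hpow, ← Real.rpow_mul hR.le, mul_assoc, ← mul_assoc (R ^ _), ← Real.rpow_add hR]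
        congr 3
        rw [show -r * (1 / r) = -1 by field_simp, hrinv]
        field_simp
        ring
  refine hL.trans ?_
  -- both sides are now combinations of the same two terms
  set s := R ^ (-(n / q : ℝ)) * S ^ (1 / q) with hs
  set t := R ^ (α / q) * R ^ (-(n / p : ℝ)) * T ^ (1 / p) with ht
  have e1 : V ^ (-(1 / r)) * (R ^ (-(n / q : ℝ)) * Z) =
      V ^ (-(1 / r)) * C * K ^ (1 / q) * (s + t) := by
    have : R ^ (-(n / q : ℝ)) * ρ = R ^ (α / q) * R ^ (-(n / p : ℝ)) := by
      rw [hρ, ← Real.rpow_add hR, ← Real.rpow_add hR]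
      congr 1
      ring
    rw [hZ, hs, ht, ← this]
    ring
  have e2 : R ^ ((n : ℝ) * -(1 / q)) = R ^ (-(n / q : ℝ)) := by congr 1; ring
  have e3 : R ^ ((n : ℝ) * -(1 / p)) = R ^ (-(n / p : ℝ)) := by congr 1; ring
  have hVq : V ^ (1 / q) * V ^ (-(1 / q)) = 1 := by
    rw [← Real.rpow_add hV, add_neg_cancel, Real.rpow_zero]
  have hVp : V ^ (1 / p) * V ^ (-(1 / p)) = 1 := by
    rw [← Real.rpow_add hV, add_neg_cancel, Real.rpow_zero]
  set M := V ^ (-(1 / r)) * C * K ^ (1 / q) with hM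
  have hAM : A * K ^ (1 / q) = M * (V ^ (1 / q) + V ^ (1 / p)) := by rw [hA, hM]; ring
  rw [e1, e2, e3]
  calc M * (s + t)
      = M * (V ^ (1 / q) * V ^ (-(1 / q))) * s + M * (V ^ (1 / p) * V ^ (-(1 / p))) * t := by
        rw [hVq, hVp]; ring
    _ = M * V ^ (1 / q) * (V ^ (-(1 / q)) * s) + M * V ^ (1 / p) * (V ^ (-(1 / p)) * t) := by ring
    _ ≤ (A * K ^ (1 / q) + 1) * (V ^ (-(1 / q)) * s) +
          (A * K ^ (1 / q) + 1) * (V ^ (-(1 / p)) * t) := by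
        have h1 : M * V ^ (1 / q) ≤ A * K ^ (1 / q) + 1 := by
          rw [hAM]
          have : 0 ≤ M * V ^ (1 / p) := by positivity
          linarith
        have h2 : M * V ^ (1 / p) ≤ A * K ^ (1 / q) + 1 := by
          rw [hAM]
          have : 0 ≤ M * V ^ (1 / q) := by positivity
          linarith
        gcongr
    _ = _ := by rw [hs, ht]; ring
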